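/- **Setting.** Let $K$ be a complete normed field of characteristic $0$ (for instance $\mathbb R$, $\mathbb C$, or formal Laurent series over $\mathbb Q$ in $q^{-1/12}$), and let $q\in K$ with $|q|>1$ be given with a fixed twelfth root $q^{1/12}$, so that $q^{x}:=(q^{1/12})^{12x}$ for $x\in\frac1{12}\mathbb Z$. Put $[n]=q^{n/2}-q^{-n/2}$, $[n]!=[1]\cdots[n]$, and for a symmetric function $f$ let $\bar f=f(q^{\rho})$ be its value at $q^\rho=(q^{-1/2},q^{-3/2},q^{-5/2},\dots)$ (the series converge). Here $h_k,e_k$ are the complete and elementary symmetric functions ($0$ for $k<0$) and $s_{(m|n)}$ is the Schur function of the hook $(m|n)=(m+1,1^n)$. Let $\mathbf a=(a_1,a_2,a_3)\in\mathbb Z^3$, and take indices $i,j\in\{1,2,3\}$ cyclically. For $m,n\ge 0$ put $$A^{ii}_{mn}=(-1)^n\frac{q^{(2a_i+1)(m(m+1)-n(n+1))/4}}{[m+n+1]\,[m]!\,[n]!},$$ $$A^{i(i\pm1)}_{mn}=\pm(-1)^n q^{\frac{(2a_i+1)m(m+1)-(2a_{i\pm1}+1)n(n+1)}{4}\pm\frac16}\sum_{l=0}^{\min(m,n)}\frac{q^{\pm\frac12(l+1)(m+n-l)}}{[m-l]!\,[n-l]!}.$$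 Let $\mathcal F$ be the fermionic Fock space, with orthonormal basis $\underline A=\underline{a_1}\wedge\underline{a_2}\wedge\cdots$ indexed by the sets $A=\{a_1>a_2>\cdots\}\subset\mathbb Z+\frac12$ that differ from the set of negative half-integers by finitely many elements. Let $\psi_r$ (insertion of $r$, with sign $(-1)^{\#\{a\in A:\,a>r\}}$, and $0$ if $r\in A$) and $\psi_r^*$ (removal of $r$, with the same sign, and $0$ if $r\notin A$) be the usual operators. Write $|\mu\rangle=\underline{A_\mu}$ with $A_\mu=\{\mu_i-i+\frac12\}_{i\ge1}$, and $|0\rangle=|\emptyset\rangle$. On $\mathcal F^{\otimes3}$ let $\psi^i_r,\psi^{i*}_r$ act on the $i$-th factor with the Koszul sign rule, and let $\psi^{ij}_{mn}=\psi^i_{m+1/2}\psi^{j*}_{-n-1/2}$. For partitions $\mu^1,\mu^2,\mu^3$, with $\mu^i=(m^i_1,\dots,m^i_{k_i}\,|\,n^i_1,\dots,n^i_{k_i})$ in Frobenius notation, put $$C^{(\mathbf a)}_{\mu^1,\mu^2,\mu^3}=\langle\mu^1,\mu^2,\mu^3|\exp\Bigl(\sum_{i,j=1}^{3}\sum_{m,n\ge0}A^{ij}_{mn}\psi^{ij}_{mn}\Bigr)|0\rangle^{\otimes3};$$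 when the exponential and the powers of the sum are expanded, only finitely many terms contribute. **Proposition.** One has $$C^{(\mathbf a)}_{\mu^1,\mu^2,\mu^3}=\sum(-1)^{r^{13}r^{21}+r^{21}r^{32}+r^{32}r^{13}+r^{12}+r^{21}}\;q^{\frac16(r^{12}+r^{23}+r^{31}-r^{21}-r^{32}-r^{13})}\;q^{\frac12\sum_{i=1}^3\sum_{t=1}^{k_i}a_i\left(m^i_t(m^i_t+1)-n^i_t(n^i_t+1)\right)}\;D_1D_2D_3,$$ where, with $\epsilon_m:=q^{m(m+1)/2}$ and $\eta_n:=q^{-n(n+1)/2}$, $$D_1=\det\begin{pmatrix}(\bar s_{(m^1_i|n^1_j)})_{k_1\times k_1}&(\bar h_{m^1_i-s'_j})_{k_1\times r^{13}}&(\epsilon_{m^1_i}\bar e_{m^1_i-t_j})_{k_1\times r^{12}}\\(\eta_{n^1_j}\bar h_{n^1_j-s_i})_{r^{21}\times k_1}&0&0\\(\bar e_{n^1_j-t'_i})_{r^{31}\times k_1}&0&0\end{pmatrix},$$ $$D_2=\det\begin{pmatrix}(\bar s_{(m^2_i|n^2_j)})_{k_2\times k_2}&(\bar h_{m^2_i-s_j})_{k_2\times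 r^{21}}&(\epsilon_{m^2_i}\bar e_{m^2_i-t''_j})_{k_2\times r^{23}}\\(\eta_{n^2_j}\bar h_{n^2_j-s''_i})_{r^{32}\times k_2}&0&0\\(\bar e_{n^2_j-t_i})_{r^{12}\times k_2}&0&0\end{pmatrix},$$ $$D_3=\det\begin{pmatrix}(\bar s_{(m^3_i|n^3_j)})_{k_3\times k_3}&(\bar h_{m^3_i-s''_j})_{k_3\times r^{32}}&(\epsilon_{m^3_i}\bar e_{m^3_i-t'_j})_{k_3\times r^{31}}\\(\eta_{n^3_j}\bar h_{n^3_j-s'_i})_{r^{13}\times k_3}&0&0\\(\bar e_{n^3_j-t''_i})_{r^{23}\times k_3}&0&0\end{pmatrix}.$$ The sum is over all integers $r^{ij}\ge0$ ($i\ne j$) with $$r^{12}+r^{13}=r^{21}+r^{31}\le k_1,\qquad r^{23}+r^{21}=r^{32}+r^{12}\le k_2,\qquad r^{31}+r^{32}=r^{13}+r^{23}\le k_3,$$ and over all strictly decreasing sequences $s,s',s'',t,t',t''$ of nonnegative integers, of lengths $r^{21},r^{13},r^{32},r^{12},r^{31},r^{23}$ respectively. Only finitely many summands are nonzero. -/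

import Mathlib

open scoped TensorProduct

namespace FramedVertex

/-! ### Specialization of symmetric functions at `q ^ ρ`

The ground field is a complete normed field `K`, and `v : K` with `1 < ‖v‖` is a chosen twelfth root
of `q`, so that `q = v ^ 12`, `q ^ (1/2) = v ^ 6`, `q ^ (1/4) = v ^ 3`, `q ^ (1/6) = v ^ 2`. -/

section Symmetric

variable {K : Type*} [NormedField K]

/-- The sequence `q ^ ρ = (q ^ (-1/2), q ^ (-3/2), q ^ (-5/2), …)`, indexed from `0`. -/
def qRho (v : K) (i : ℕ) : K := v ^ (-(12 * (i : ℤ) + 6))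

/-- The complete homogeneous symmetric function `h_n(x_0, x_1, …)`:
the sum of all monomials of degree `n`. -/
noncomputable def completeSymm (x : ℕ → K) (n : ℕ) : K :=
  ∑' s : Sym ℕ n, ((s : Multiset ℕ).map x).prod

/-- The elementary symmetric function `e_n(x_0, x_1, …)`:
the sum of all squarefree monomials of degree `n`. -/
noncomputable def elemSymm (x : ℕ → K) (n : ℕ) : K :=
  ∑' s : {s : Finset ℕ // s.card = n}, ∏ i ∈ s.1, x i

/-- The Schur function `s_μ(x_0, x_1, …)`: the sum over semistandard tableaux `T` of shape `μ` of
the monomials `∏_{c ∈ μ} x_{T(c)}`. -/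
noncomputable def schur (x : ℕ → K) (μ : YoungDiagram) : K :=
  ∑' T : SemistandardYoungTableau μ, ∏ c ∈ μ.cells, x (T c.1 c.2)

/-- The hook partition `(m | n)` in Frobenius notation, i.e. `(m + 1, 1, …, 1)` with `n` ones. -/
def hook (m n : ℕ) : YoungDiagram where
  cells := (Finset.range (m + 1)).image (fun j => ((0 : ℕ), j)) ∪
    (Finset.range (n + 1)).image (fun i => (i, (0 : ℕ)))
  isLowerSet := by
    rintro ⟨i, j⟩ ⟨i', j'⟩ ⟨h1, h2⟩ h
    simp only [Finset.coe_union, Finset.coe_image, Finset.coe_range, Set.mem_union, Set.mem_image,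
      Set.mem_Iio, Prod.mk.injEq] at h h1 h2 ⊢
    rcases h with ⟨x, hx, h, h'⟩ | ⟨x, hx, h, h'⟩
    · exact Or.inl ⟨j', by omega, by omega, rfl⟩
    · exact Or.inr ⟨i', by omega, rfl, by omega⟩

/-- `s_{(m|n)}(q ^ ρ)`. -/
noncomputable def sBar (v : K) (m n : ℕ) : K := schur (qRho v) (hook m n)

/-- `h_k(q ^ ρ)` for an integer `k`, with `h_k = 0` for `k < 0`. -/
noncomputable def hBar (v : K) : ℤ → K
  | Int.ofNat k => completeSymm (qRho v) k
  | Int.negSucc _ => 0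

/-- `e_k(q ^ ρ)` for an integer `k`, with `e_k = 0` for `k < 0`. -/
noncomputable def eBar (v : K) : ℤ → K
  | Int.ofNat k => elemSymm (qRho v) k
  | Int.negSucc _ => 0

end Symmetric

/-! ### Frobenius notation -/

/-- The number `k` of boxes on the diagonal of `μ`. -/
def diagLen (μ : YoungDiagram) : ℕ := (μ.cells.filter fun c => c.1 = c.2).card

/-- The Frobenius coordinate `m_{t+1} = μ_{t+1} - (t+1)`, for `t < diagLen μ`. -/
def arm (μ : YoungDiagram) (t : ℕ) : ℕ := μ.rowLen t - (t + 1)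

/-- The Frobenius coordinate `n_{t+1} = μᵗ_{t+1} - (t+1)`, for `t < diagLen μ`. -/
def leg (μ : YoungDiagram) (t : ℕ) : ℕ := μ.colLen t - (t + 1)

/-! ### The fermionic Fock space

The half-integer `p + 1/2` is represented by the integer `p`; the negative half-integers correspond
to `Set.Iio 0`. -/

/-- Admissible sets of half-integers. -/
def Admissible : Type :=
  {A : Set ℤ // (Set.Iio 0 \ A).Finite ∧ (A \ Set.Iio 0).Finite}

namespace Admissible

/-- The charge of an admissible set. -/
noncomputable def charge (A : Admissible) : ℤ :=
  ((A.1 \ Set.Iio 0).ncard : ℤ) - ((Set.Iio 0 \ A.1).ncard : ℤ)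

/-- The number of elements of `A` that are greater than `r`. -/
noncomputable def above (A : Admissible) (r : ℤ) : ℕ := {a ∈ A.1 | r < a}.ncard

/-- `A ∪ {r}`. -/
def add (A : Admissible) (r : ℤ) : Admissible :=
  ⟨insert r A.1, A.2.1.subset fun _ hx => ⟨hx.1, fun h => hx.2 (Or.inr h)⟩,
    (A.2.2.insert r).subset fun _ hx => hx.1.imp id fun h => ⟨h, hx.2⟩⟩

/-- `A \ {r}`. -/
def remove (A : Admissible) (r : ℤ) : Admissible :=
  ⟨A.1 \ {r}, (A.2.1.insert r).subset fun x hx => by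
      by_cases h : x = r
      · exact Or.inl h
      · exact Or.inr ⟨hx.1, fun hA => hx.2 ⟨hA, h⟩⟩,
    A.2.2.subset fun _ hx => ⟨hx.1.1, hx.2⟩⟩

/-- The vacuum `{-1/2, -3/2, …}`. -/
def vacuum : Admissible := ⟨Set.Iio 0, by simp, by simp⟩

/-- The set `A_μ = {μ_i - i + 1/2 : i = 1, 2, …}`. -/
def ofPartition (μ : YoungDiagram) : Admissible :=
  ⟨Set.range fun t : ℕ => (μ.rowLen t : ℤ) - (t + 1), by
    have h0 : ∀ t : ℕ, μ.colLen 0 ≤ t → μ.rowLen t = 0 := fun t ht => by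
      by_contra h
      have h1 : (t, 0) ∈ μ := YoungDiagram.mem_iff_lt_rowLen.2 (Nat.pos_of_ne_zero h)
      have h2 := YoungDiagram.mem_iff_lt_colLen.1 h1
      omega
    constructor
    · refine (Set.finite_Ico (-(μ.colLen 0 : ℤ)) 0).subset ?_
      rintro x ⟨hx, hx'⟩
      simp only [Set.mem_Iio] at hx
      refine ⟨?_, hx⟩
      by_contra hlt
      refine hx' ⟨(-x - 1).toNat, ?_⟩
      have h1 := h0 (-x - 1).toNat (by omega)
      simp only [h1]
      omega
    · refine ((Set.finite_Iio (μ.colLen 0)).image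
        fun t : ℕ => (μ.rowLen t : ℤ) - (t + 1)).subset ?_
      rintro x ⟨⟨t, rfl⟩, hx'⟩
      refine ⟨t, ?_, rfl⟩
      by_contra hlt
      refine hx' ?_
      have h1 := h0 t (by simpa using hlt)
      simp only [h1, Set.mem_Iio]
      omega⟩

end Admissible

section Fock

variable (K : Type*) [Field K]

/-- The fermionic Fock space `ℱ`, with basis the admissible sets. -/
abbrev Fock : Type _ := Admissible →₀ K

/-- The basis vector `|A⟩`. -/
noncomputable abbrev ket (A : Admissible) : Fock K := Finsupp.single A 1

open Classical in
/-- The operator `ψ_{r + 1/2}`. -/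
noncomputable def psi (r : ℤ) : Module.End K (Fock K) :=
  Finsupp.linearCombination K fun A : Admissible =>
    if r ∈ A.1 then 0 else (-1 : K) ^ A.above r • ket K (A.add r)

open Classical in
/-- The operator `ψ*_{r + 1/2}`. -/
noncomputable def psiStar (r : ℤ) : Module.End K (Fock K) :=
  Finsupp.linearCombination K fun A : Admissible =>
    if r ∈ A.1 then (-1 : K) ^ A.above r • ket K (A.remove r) else 0

/-- The parity operator `|A⟩ ↦ (-1) ^ charge A |A⟩`. -/
noncomputable def parity : Module.End K (Fock K) :=
  Finsupp.linearCombination K fun A : Admissible => (-1 : K) ^ A.charge • ket K A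

/-- The three-component Fock space `ℱ ⊗ ℱ ⊗ ℱ`. -/
abbrev Fock3 : Type _ := Fock K ⊗[K] (Fock K ⊗[K] Fock K)

/-- An odd operator `T` of `ℱ` acting on the `i`-th tensor factor,
with the Koszul sign from the factors to its left. -/
noncomputable def onFactor (i : Fin 3) (T : Module.End K (Fock K)) : Module.End K (Fock3 K) :=
  match i with
  | 0 => TensorProduct.map T (TensorProduct.map LinearMap.id LinearMap.id)
  | 1 => TensorProduct.map (parity K) (TensorProduct.map T LinearMap.id)
  | 2 => TensorProduct.map (parity K) (TensorProduct.map (parity K) T)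

/-- `ψ^{ij}_{mn} = ψ^i_{m + 1/2} ψ^{j*}_{-n - 1/2}`. -/
noncomputable def psiPair (i j : Fin 3) (m n : ℕ) : Module.End K (Fock3 K) :=
  onFactor K i (psi K (m : ℤ)) * onFactor K j (psiStar K (-(n : ℤ) - 1))

/-- The vector `|0⟩ ⊗ |0⟩ ⊗ |0⟩`. -/
noncomputable def vac3 : Fock3 K :=
  ket K .vacuum ⊗ₜ[K] (ket K .vacuum ⊗ₜ[K] ket K .vacuum)

/-- The functional `⟨μ¹, μ², μ³|` on `ℱ ⊗ ℱ ⊗ ℱ`: the inner product with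
`|μ¹⟩ ⊗ |μ²⟩ ⊗ |μ³⟩`, for the inner product in which the basis vectors are orthonormal. -/
noncomputable def bra3 (μ : Fin 3 → YoungDiagram) : Fock3 K →ₗ[K] K :=
  LinearMap.mul' K K ∘ₗ TensorProduct.map (Finsupp.lapply (.ofPartition (μ 0)))
    (LinearMap.mul' K K ∘ₗ TensorProduct.map (Finsupp.lapply (.ofPartition (μ 1)))
      (Finsupp.lapply (.ofPartition (μ 2))))

end Fock

/-! ### The framed coefficients and the fermionic matrix elements -/

section Fermionic

variable {K : Type*} [Field K]

/-- `[n] = q ^ (n/2) - q ^ (-n/2)`. -/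
def qNum (v : K) (n : ℕ) : K := v ^ (6 * (n : ℤ)) - v ^ (-(6 * (n : ℤ)))

/-- `[n]! = [1] [2] ⋯ [n]`. -/
def qFact (v : K) (n : ℕ) : K := ∏ j ∈ Finset.range n, qNum v (j + 1)

/-- The framed coefficients `A^{ij}_{mn}(q; a₁, a₂, a₃)`, with cyclic indices `i, j`:
* `A^{ii}_{mn} = (-1)^n q^{(2a_i+1)(m(m+1)-n(n+1))/4} / ([m+n+1] [m]! [n]!)`;
* `A^{i,i+1}_{mn} = (-1)^n q^{((2a_i+1)m(m+1)-(2a_{i+1}+1)n(n+1))/4 + 1/6}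
    ∑_{l=0}^{min(m,n)} q^{(l+1)(m+n-l)/2} / ([m-l]! [n-l]!)`;
* `A^{i,i-1}_{mn} = -(-1)^n q^{((2a_i+1)m(m+1)-(2a_{i-1}+1)n(n+1))/4 - 1/6}
    ∑_{l=0}^{min(m,n)} q^{-(l+1)(m+n-l)/2} / ([m-l]! [n-l]!)`. -/
def framedCoeff (v : K) (a : Fin 3 → ℤ) (i j : Fin 3) (m n : ℕ) : K :=
  if j = i then
    (-1) ^ n * v ^ (3 * ((2 * a i + 1) * ((m : ℤ) * (m + 1) - (n : ℤ) * (n + 1)))) /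
      (qNum v (m + n + 1) * qFact v m * qFact v n)
  else if j = i + 1 then
    (-1) ^ n *
      v ^ (3 * ((2 * a i + 1) * ((m : ℤ) * (m + 1)) - (2 * a j + 1) * ((n : ℤ) * (n + 1))) + 2) *
      ∑ l ∈ Finset.range (min m n + 1),
        v ^ (6 * (((l : ℤ) + 1) * (m + n - l))) / (qFact v (m - l) * qFact v (n - l))
  else
    -(-1) ^ n *
      v ^ (3 * ((2 * a i + 1) * ((m : ℤ) * (m + 1)) - (2 * a j + 1) * ((n : ℤ) * (n + 1))) - 2) *
      ∑ l ∈ Finset.range (min m n + 1),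
        v ^ (-(6 * (((l : ℤ) + 1) * (m + n - l)))) / (qFact v (m - l) * qFact v (n - l))

/-- An index `(i, j, m, n)` of the sum `∑ A^{ij}_{mn} ψ^{ij}_{mn}`. -/
abbrev PairIndex : Type := Fin 3 × Fin 3 × ℕ × ℕ

/-- The contribution of a word `w = (w₁, …, w_k)` of indices to the matrix element
`⟨μ¹, μ², μ³| exp(∑ A^{ij}_{mn} ψ^{ij}_{mn}) |0⟩^{⊗3}`, after the exponential and the powers of the
sum are expanded:
`(1 / k!) A_{w₁} ⋯ A_{w_k} ⟨μ¹, μ², μ³| ψ_{w₁} ⋯ ψ_{w_k} |0⟩^{⊗3}`. -/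
noncomputable def wordTerm (v : K) (a : Fin 3 → ℤ) (μ : Fin 3 → YoungDiagram)
    (w : List PairIndex) : K :=
  ((w.length.factorial : ℕ) : K)⁻¹ *
    (w.map fun x => framedCoeff v a x.1 x.2.1 x.2.2.1 x.2.2.2).prod *
    bra3 K μ ((w.map fun x => psiPair K x.1 x.2.1 x.2.2.1 x.2.2.2).prod (vac3 K))

/-- `C^{(a)}_{μ¹,μ²,μ³} = ⟨μ¹, μ², μ³| exp(∑ A^{ij}_{mn}(q; a) ψ^{ij}_{mn}) |0⟩^{⊗3}`
(only finitely many words contribute). -/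
noncomputable def fermionicVertex (v : K) (a : Fin 3 → ℤ) (μ : Fin 3 → YoungDiagram) : K :=
  ∑ᶠ w : List PairIndex, wordTerm v a μ w

end Fermionic

/-! ### The determinantal side -/

/-- The index set of the determinantal sum for diagonal lengths `k₁, k₂, k₃`: numbers `r^{ij} ≥ 0`
for `i ≠ j`, and for each `i ≠ j` a strictly decreasing sequence of nonnegative integers of length
`r^{ij}`. With components numbered `0, 1, 2` instead of `1, 2, 3`, the sequences are
`s = seq 1 0`, `s' = seq 0 2`, `s'' = seq 2 1`, `t = seq 0 1`, `t' = seq 2 0`, `t'' = seq 1 2`.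
The diagonal entries are unused (`r i i = 0`). -/
structure SumIndex (k : Fin 3 → ℕ) where
  r : Fin 3 → Fin 3 → ℕ
  r_diag : ∀ i, r i i = 0
  seq : ∀ i j, Fin (r i j) → ℕ
  seq_anti : ∀ i j, StrictAnti (seq i j)
  balance : ∀ i, r i (i + 2) + r i (i + 1) = r (i + 1) i + r (i + 2) i
  bound : ∀ i, r i (i + 2) + r i (i + 1) ≤ k i

/-- Consecutive numbering of the rows (or columns) of a three-block matrix. -/
def blockEquiv (k x y : ℕ) : Fin (k + (x + y)) ≃ Fin k ⊕ (Fin x ⊕ Fin y) :=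
  ((Equiv.sumCongr (Equiv.refl _) finSumFinEquiv).trans finSumFinEquiv).symm

section Determinantal

variable {K : Type*} [NormedField K]

/-- The `i`-th block matrix (`m_p, n_p` are the Frobenius coordinates of `μ^i`):
* rows: `k_i` rows, then `r^{i+1,i}` rows, then `r^{i-1,i}` rows;
* columns: `k_i` columns, then `r^{i,i-1}` columns, then `r^{i,i+1}` columns.

The entries are `s̄_{(m_p|n_b)}`, `h̄_{m_p - s}`, `q^{m_p(m_p+1)/2} ē_{m_p - t}` in the upper rows,
`q^{-n_b(n_b+1)/2} h̄_{n_b - s}` and `ē_{n_b - t}` in the lower left blocks, and `0` elsewhere. -/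
noncomputable def blockMatrix (v : K) (μ : Fin 3 → YoungDiagram)
    (J : SumIndex fun i => diagLen (μ i)) (i : Fin 3) :
    Matrix (Fin (diagLen (μ i)) ⊕ (Fin (J.r (i + 1) i) ⊕ Fin (J.r (i + 2) i)))
      (Fin (diagLen (μ i)) ⊕ (Fin (J.r i (i + 2)) ⊕ Fin (J.r i (i + 1)))) K
  | .inl p, .inl b => sBar v (arm (μ i) p) (leg (μ i) b)
  | .inl p, .inr (.inl b) => hBar v ((arm (μ i) p : ℤ) - J.seq i (i + 2) b)
  | .inl p, .inr (.inr b) =>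
      v ^ (6 * ((arm (μ i) p : ℤ) * (arm (μ i) p + 1))) *
        eBar v ((arm (μ i) p : ℤ) - J.seq i (i + 1) b)
  | .inr (.inl p), .inl b =>
      v ^ (-(6 * ((leg (μ i) b : ℤ) * (leg (μ i) b + 1)))) *
        hBar v ((leg (μ i) b : ℤ) - J.seq (i + 1) i p)
  | .inr (.inr p), .inl b => eBar v ((leg (μ i) b : ℤ) - J.seq (i + 2) i p)
  | .inr _, .inr _ => 0

/-- The determinant of the `i`-th block matrix, which is square by the balance condition. -/
noncomputable def blockDet (v : K) (μ : Fin 3 → YoungDiagram)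
    (J : SumIndex fun i => diagLen (μ i)) (i : Fin 3) : K :=
  ((blockMatrix v μ J i).submatrix (blockEquiv _ _ _)
    fun b => blockEquiv _ _ _
      (Fin.cast (congrArg (diagLen (μ i) + ·) (J.balance i)).symm b)).det

/-- The summand of the determinantal formula:
`(-1)^{r^{13}r^{21} + r^{21}r^{32} + r^{32}r^{13} + r^{12} + r^{21}}`
`q^{(r^{12}+r^{23}+r^{31}-r^{21}-r^{32}-r^{13})/6}`
`q^{∑_i ∑_t a_i (m^i_t(m^i_t+1) - n^i_t(n^i_t+1))/2}` times the three block determinants. -/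
noncomputable def detTerm (v : K) (a : Fin 3 → ℤ) (μ : Fin 3 → YoungDiagram)
    (J : SumIndex fun i => diagLen (μ i)) : K :=
  (-1) ^ (J.r 0 2 * J.r 1 0 + J.r 1 0 * J.r 2 1 + J.r 2 1 * J.r 0 2 + J.r 0 1 + J.r 1 0) *
    v ^ (2 * ((J.r 0 1 : ℤ) + J.r 1 2 + J.r 2 0 - J.r 1 0 - J.r 2 1 - J.r 0 2)) *
    v ^ (∑ i : Fin 3, ∑ t ∈ Finset.range (diagLen (μ i)),
      6 * (a i * ((arm (μ i) t : ℤ) * (arm (μ i) t + 1) -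
        (leg (μ i) t : ℤ) * (leg (μ i) t + 1)))) *
    ∏ i : Fin 3, blockDet v μ J i

end Determinantal

end FramedVertex

/-! The matrix element is a determinant by Wick's theorem. The creators have modes `≥ 0` and the
annihilators modes `< 0`, so all of them anticommute. A word of pairs contributes only if it uses
every arm and every leg of the three partitions exactly once. Such a word is given by two
permutations of the diagonal hooks, and its vacuum value is the product of their signs times
`(-1)^(∑ n)`. Summing over both permutations cancels the `1/k!` of the exponential and leaves
`(-1)^(∑ n)` times the determinant of the coefficients `A^{ij}_{mn}` at the Frobenius coordinates
(`fermionicVertex_eq_det`).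

Since `q^ρ` is a geometric sequence, its `h`, `e` and hook Schur values have closed forms. By these
(`framedCoeff_eq`), once a monomial is removed from each row and a monomial with sign `(-1)^n` from
each column, the coefficient matrix becomes `S + U W V`. Here `S` is block diagonal with hook Schur
entries, `U` and `V` carry the `e` and `h` entries of the bordering columns and rows, and `W` is
diagonal with entries `q^(1/6)`, `-q^(-1/6)` and `0`. The inner index is a pair `(i, j)` with a
number `l`. The column signs cancel `(-1)^(∑ n)`, and the monomials give the framing factor.

A Cauchy–Binet expansion (`det_add_mul_diagonal_mul`) turns the determinant into a sum over sets `T`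
of inner labels of bordered minors of `S`. The sets that matter correspond to the six decreasing
sequences. The bordering column of `(i, j)` lives on the hooks of `μ^i` and the bordering row on
those of `μ^j`. Sorting rows and columns accordingly makes the bordered matrix block diagonal with
blocks `D_1, D_2, D_3`, and a nonzero minor forces the conditions on the `r^{ij}`
(`exists_sumIndex_of_minorTerm_ne_zero`). Rows and columns are sorted differently; the resulting
sign, reduced modulo 2 by the balance conditions and combined with the signs from `W`, is the one in
the formula (`sign_mul_prod_coupling`). -/

namespace FramedVertex

/-! ### Elementary and complete symmetric functions of a geometric sequence -/

section Geometric

/-- Adjoining a minimum `j` to a finite set translated above `j`. -/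
def consFinset (n : ℕ) (z : ℕ × {s : Finset ℕ // s.card = n}) : {s : Finset ℕ // s.card = n + 1} :=
  ⟨Finset.cons z.1 (z.2.1.map (addRightEmbedding (z.1 + 1))) (by simp; omega), by
    rw [Finset.card_cons, Finset.card_map, z.2.2]⟩

/-- Adjoining a minimum `j` to a multiset translated by `j`. -/
def consSym (n : ℕ) (z : ℕ × Sym ℕ n) : Sym ℕ (n + 1) :=
  z.1 ::ₛ z.2.map (· + z.1)

theorem consFinset_bijective (n : ℕ) : Function.Bijective (consFinset n) := by
  constructor
  · rintro ⟨j, s, hs⟩ ⟨j', s', hs'⟩ h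
    have h1 : insert j (s.map (addRightEmbedding (j + 1))) =
        insert j' (s'.map (addRightEmbedding (j' + 1))) := by
      simpa [consFinset] using congrArg Subtype.val h
    -- If the minima differed, each would be strictly larger than the other.
    have e : j = j' := by
      have a1 : j ∈ insert j' (s'.map (addRightEmbedding (j' + 1))) := by rw [← h1]; simp
      have a2 : j' ∈ insert j (s.map (addRightEmbedding (j + 1))) := by rw [h1]; simp
      simp only [Finset.mem_insert, Finset.mem_map, addRightEmbedding_apply] at a1 a2
      rcases a1 with a1 | ⟨x, -, hx⟩
      · exact a1
      · rcases a2 with a2 | ⟨y, -, hy⟩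
        · exact a2.symm
        · omega
    subst e
    have h2 := congrArg (fun t => Finset.erase t j) h1
    rw [Finset.erase_insert (by simp; omega), Finset.erase_insert (by simp; omega)] at h2
    have h3 := Finset.map_injective _ h2
    subst h3
    rfl
  · rintro ⟨s, hs⟩
    have hne : s.Nonempty := Finset.card_pos.1 (by omega)
    set j := s.min' hne with hj
    have hjs : j ∈ s := s.min'_mem hne
    have key : ((s.erase j).image (· - (j + 1))).map (addRightEmbedding (j + 1)) = s.erase j := by
      ext y
      simp only [Finset.mem_map, Finset.mem_image, addRightEmbedding_apply]
      constructor
      · rintro ⟨_, ⟨x, hx, rfl⟩, rfl⟩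
        have := s.min'_lt_of_mem_erase_min' hne (by simpa [hj] using hx)
        rwa [Nat.sub_add_cancel (by omega)]
      · intro hy
        have := s.min'_lt_of_mem_erase_min' hne (by simpa [hj] using hy)
        exact ⟨_, ⟨y, hy, rfl⟩, Nat.sub_add_cancel (by omega)⟩
    refine ⟨⟨j, (s.erase j).image (· - (j + 1)), ?_⟩, ?_⟩
    · rw [← Finset.card_map (addRightEmbedding (j + 1)), key, Finset.card_erase_of_mem hjs]
      omega
    · apply Subtype.ext
      simp only [consFinset, key, Finset.cons_eq_insert, Finset.insert_erase hjs]

theorem consSym_bijective (n : ℕ) : Function.Bijective (consSym n) := by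
  constructor
  · rintro ⟨j, s⟩ ⟨j', s'⟩ h
    have e : j = j' := by
      have a1 : j ∈ consSym n (j', s') := by rw [← h]; simp [consSym]
      have a2 : j' ∈ consSym n (j, s) := by rw [h]; simp [consSym]
      simp only [consSym, Sym.mem_cons, Sym.mem_map] at a1 a2
      rcases a1 with a1 | ⟨x, -, hx⟩
      · exact a1
      · rcases a2 with a2 | ⟨y, -, hy⟩
        · exact a2.symm
        · omega
    subst e
    simp only [consSym, Sym.cons_inj_right] at h
    rw [Sym.map_injective (add_left_injective j) n h]
  · intro s
    have hne : (s : Multiset ℕ).toFinset.Nonempty := by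
      rw [Multiset.toFinset_nonempty]
      intro h0
      have := s.2
      rw [show s.1 = 0 from h0] at this
      simp at this
    set j := (s : Multiset ℕ).toFinset.min' hne with hj
    have hjs : j ∈ s := by
      have := Finset.min'_mem _ hne
      rwa [Multiset.mem_toFinset] at this
    refine ⟨(j, (s.erase j hjs).map (· - j)), ?_⟩
    have : ((s.erase j hjs).map (· - j)).map (· + j) = s.erase j hjs := by
      rw [Sym.map_map]
      conv_rhs => rw [← Sym.map_id' (s.erase j hjs)]
      refine Sym.map_congr fun x hx => ?_
      have hx' : x ∈ (s : Multiset ℕ) := Multiset.mem_of_mem_erase (a := x) (b := j) hx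
      have := Finset.min'_le _ x (Multiset.mem_toFinset.2 hx')
      simp only [Function.comp]
      omega
    simp only [consSym, this, Sym.cons_erase]

variable {K : Type*} [NormedField K] {x : ℕ → K} {c p : K}

theorem elemSymm_zero (x : ℕ → K) : elemSymm x 0 = 1 := by
  unfold elemSymm
  have : Unique {s : Finset ℕ // s.card = 0} :=
    ⟨⟨⟨∅, rfl⟩⟩, fun s => Subtype.ext (Finset.card_eq_zero.1 s.2)⟩
  rw [tsum_fintype, Fintype.sum_unique]
  rw [Finset.card_eq_zero.1 (default : {s : Finset ℕ // s.card = 0}).2, Finset.prod_empty]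

theorem completeSymm_zero (x : ℕ → K) : completeSymm x 0 = 1 := by
  unfold completeSymm
  rw [tsum_fintype, Fintype.sum_unique]
  simp [default, Sym.nil]

theorem norm_pow_lt_one (hp : ‖p‖ < 1) (n : ℕ) : ‖p ^ (n + 1)‖ < 1 := by
  rw [norm_pow]
  exact pow_lt_one₀ (norm_nonneg _) hp (by omega)

variable [CompleteSpace K]

/-- Split an `(n+1)`-set into its minimum `j` and the remaining `n` elements translated down by `j +
1`. The monomial acquires the factor `c p^n (p^(n+1))^j`, and the sum over `j` is a geometric
series. Summability is proved along with the recursion because the double sum factors by absolute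
convergence. -/
theorem elemSymm_succ_aux (hp : ‖p‖ < 1) (hx : ∀ i, x i = c * p ^ i) (n : ℕ)
    (hs : Summable fun s : {s : Finset ℕ // s.card = n} => ‖∏ i ∈ s.1, x i‖) :
    (Summable fun s : {s : Finset ℕ // s.card = n + 1} => ‖∏ i ∈ s.1, x i‖) ∧
      elemSymm x (n + 1) = c * p ^ n / (1 - p ^ (n + 1)) * elemSymm x n := by
  let e := Equiv.ofBijective _ (consFinset_bijective n)
  have hterm : ∀ z, ∏ i ∈ (e z).1, x i =
      (c * p ^ n * (p ^ (n + 1)) ^ z.1) * ∏ i ∈ z.2.1, x i := by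
    rintro ⟨j, s, hs⟩
    have : (e (j, ⟨s, hs⟩)).1 = Finset.cons j (s.map (addRightEmbedding (j + 1))) (by simp; omega) := rfl
    rw [this, Finset.prod_cons, Finset.prod_map]
    simp only [addRightEmbedding_apply, hx]
    have : ∀ i ∈ s, c * p ^ (i + (j + 1)) = p ^ (j + 1) * (c * p ^ i) := fun i _ => by ring
    rw [Finset.prod_congr rfl this, Finset.prod_mul_distrib, Finset.prod_const, hs]
    ring
  have hg : Summable fun j : ℕ => ‖c * p ^ n * (p ^ (n + 1)) ^ j‖ := by
    simp_rw [norm_mul _ (_ ^ _), norm_pow (p ^ (n + 1))]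
    exact (summable_geometric_of_lt_one (norm_nonneg _) (norm_pow_lt_one hp n)).mul_left _
  constructor
  · rw [← e.summable_iff]
    refine (Summable.mul_norm hg hs).congr fun z => ?_
    rw [Function.comp_apply, hterm]
  · unfold elemSymm
    rw [← e.tsum_eq]
    simp_rw [hterm]
    rw [← tsum_mul_tsum_of_summable_norm hg hs, tsum_mul_left,
      tsum_geometric_of_norm_lt_one (norm_pow_lt_one hp n)]
    ring

/-- As in `elemSymm_succ_aux`, but repetitions are allowed, so the rest is translated by `j` only
and the factor `p^n` disappears. -/
theorem completeSymm_succ_aux (hp : ‖p‖ < 1) (hx : ∀ i, x i = c * p ^ i) (n : ℕ)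
    (hs : Summable fun s : Sym ℕ n => ‖((s : Multiset ℕ).map x).prod‖) :
    (Summable fun s : Sym ℕ (n + 1) => ‖((s : Multiset ℕ).map x).prod‖) ∧
      completeSymm x (n + 1) = c / (1 - p ^ (n + 1)) * completeSymm x n := by
  let e := Equiv.ofBijective _ (consSym_bijective n)
  have hterm : ∀ z, ((e z : Multiset ℕ).map x).prod =
      (c * (p ^ (n + 1)) ^ z.1) * ((z.2 : Multiset ℕ).map x).prod := by
    rintro ⟨j, s⟩
    have : (e (j, s) : Multiset ℕ) = j ::ₘ (s : Multiset ℕ).map (· + j) := by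
      change ((j ::ₛ s.map (· + j) : Sym ℕ (n + 1)) : Multiset ℕ) = _
      rw [Sym.coe_cons, Sym.coe_map]
    rw [this, Multiset.map_cons, Multiset.prod_cons, Multiset.map_map]
    have : (s : Multiset ℕ).map (x ∘ (· + j)) = (s : Multiset ℕ).map fun i => p ^ j * x i :=
      Multiset.map_congr rfl fun i _ => by simp only [Function.comp, hx]; ring
    rw [this, Multiset.prod_map_mul, Multiset.map_const', Multiset.prod_replicate, Sym.card_coe, hx]
    ring
  have hg : Summable fun j : ℕ => ‖c * (p ^ (n + 1)) ^ j‖ := by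
    simp_rw [norm_mul, norm_pow (p ^ (n + 1))]
    exact (summable_geometric_of_lt_one (norm_nonneg _) (norm_pow_lt_one hp n)).mul_left _
  constructor
  · rw [← e.summable_iff]
    refine (Summable.mul_norm hg hs).congr fun z => ?_
    rw [Function.comp_apply, hterm]
  · unfold completeSymm
    rw [← e.tsum_eq]
    simp_rw [hterm]
    rw [← tsum_mul_tsum_of_summable_norm hg hs, tsum_mul_left,
      tsum_geometric_of_norm_lt_one (norm_pow_lt_one hp n)]
    ring

theorem summable_norm_elemSymm (hp : ‖p‖ < 1) (hx : ∀ i, x i = c * p ^ i) (n : ℕ) :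
    Summable fun s : {s : Finset ℕ // s.card = n} => ‖∏ i ∈ s.1, x i‖ := by
  induction n with
  | zero =>
    have : Unique {s : Finset ℕ // s.card = 0} :=
      ⟨⟨⟨∅, rfl⟩⟩, fun s => Subtype.ext (Finset.card_eq_zero.1 s.2)⟩
    exact (hasSum_fintype _).summable
  | succ n ih => exact (elemSymm_succ_aux hp hx n ih).1

theorem elemSymm_succ (hp : ‖p‖ < 1) (hx : ∀ i, x i = c * p ^ i) (n : ℕ) :
    elemSymm x (n + 1) = c * p ^ n / (1 - p ^ (n + 1)) * elemSymm x n :=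
  (elemSymm_succ_aux hp hx n (summable_norm_elemSymm hp hx n)).2

theorem summable_norm_completeSymm (hp : ‖p‖ < 1) (hx : ∀ i, x i = c * p ^ i) (n : ℕ) :
    Summable fun s : Sym ℕ n => ‖((s : Multiset ℕ).map x).prod‖ := by
  induction n with
  | zero => exact (hasSum_fintype _).summable
  | succ n ih => exact (completeSymm_succ_aux hp hx n ih).1

theorem completeSymm_succ (hp : ‖p‖ < 1) (hx : ∀ i, x i = c * p ^ i) (n : ℕ) :
    completeSymm x (n + 1) = c / (1 - p ^ (n + 1)) * completeSymm x n :=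
  (completeSymm_succ_aux hp hx n (summable_norm_completeSymm hp hx n)).2

end Geometric

/-! ### Schur functions of hooks at a geometric sequence -/

section HookTableaux

theorem mem_hook {m n i j : ℕ} : (i, j) ∈ hook m n ↔ (i = 0 ∧ j ≤ m) ∨ (j = 0 ∧ i ≤ n) := by
  rw [← YoungDiagram.mem_cells]
  simp only [hook, Finset.mem_union, Finset.mem_image, Finset.mem_range, Prod.mk.injEq]
  constructor
  · rintro (⟨x, hx, h, h'⟩ | ⟨x, hx, h, h'⟩) <;> omega
  · rintro (⟨h, h'⟩ | ⟨h, h'⟩)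
    · exact Or.inl ⟨j, by omega, by omega, rfl⟩
    · exact Or.inr ⟨i, by omega, rfl, by omega⟩

theorem prod_cells_hook {M : Type*} [CommMonoid M] (m n : ℕ) (f : ℕ × ℕ → M) :
    ∏ c ∈ (hook m n).cells, f c =
      f (0, 0) * (∏ j ∈ Finset.range m, f (0, j + 1)) * ∏ i ∈ Finset.range n, f (i + 1, 0) := by
  have h : (hook m n).cells = (Finset.range (m + 1)).image (fun j => ((0 : ℕ), j)) ∪
      (Finset.range n).image (fun i => (i + 1, (0 : ℕ))) := by
    ext ⟨i, j⟩
    rw [YoungDiagram.mem_cells, mem_hook]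
    simp only [Finset.mem_union, Finset.mem_image, Finset.mem_range, Prod.mk.injEq]
    constructor
    · rintro (⟨h, h'⟩ | ⟨h, h'⟩)
      · exact Or.inl ⟨j, by omega, by omega, rfl⟩
      · rcases i with _ | i
        · exact Or.inl ⟨0, by omega, rfl, by omega⟩
        · exact Or.inr ⟨i, by omega, rfl, by omega⟩
    · rintro (⟨x, hx, h, h'⟩ | ⟨x, hx, h, h'⟩) <;> omega
  rw [h, Finset.prod_union, Finset.prod_image, Finset.prod_image, Finset.prod_range_succ', mul_comm (f (0, 0))]
  · intro a _ b _ hab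
    simpa using hab
  · intro a _ b _ hab
    simpa using hab
  · rw [Finset.disjoint_left]
    rintro ⟨i, j⟩ h1 h2
    simp only [Finset.mem_image, Finset.mem_range, Prod.mk.injEq] at h1 h2
    obtain ⟨_, _, h, _⟩ := h1
    obtain ⟨_, _, h', _⟩ := h2
    omega

theorem prod_map_eq_prod_range_getD {α M : Type*} [CommMonoid M] (l : List α) (d : α) (f : α → M) :
    (l.map f).prod = ∏ j ∈ Finset.range l.length, f (l.getD j d) := by
  induction l with
  | nil => simp
  | cons a l ih => simp [Finset.prod_range_succ', ih, mul_comm]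

/-- The semistandard tableau of hook shape with corner entry `c`, whose first row and column are
given by a multiset (relative to `c`) and by a set (relative to `c + 1`). -/
def hookTableau (m n : ℕ) (z : ℕ × (Sym ℕ m × {s : Finset ℕ // s.card = n})) :
    SemistandardYoungTableau (hook m n) where
  entry i j :=
    if (i, j) ∈ hook m n then
      if i = 0 then
        if j = 0 then z.1 else z.1 + ((z.2.1 : Multiset ℕ).sort (· ≤ ·)).getD (j - 1) 0
      else z.1 + 1 + (z.2.2.1.sort (· ≤ ·)).getD (i - 1) 0
    else 0
  row_weak' := by
    intro i j1 j2 hj h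
    have h1 : (i, j1) ∈ hook m n := (hook m n).up_left_mem le_rfl hj.le h
    have h' := mem_hook.1 h
    obtain ⟨rfl, h2⟩ : i = 0 ∧ j2 ≤ m := by omega
    simp only [h, h1, if_true, if_neg (show j2 ≠ 0 by omega)]
    split_ifs with h0
    · omega
    · have hl : ((z.2.1 : Multiset ℕ).sort (· ≤ ·)).length = m := by simp
      rw [List.getD_eq_getElem _ _ (by omega), List.getD_eq_getElem _ _ (by omega)]
      have := (Multiset.pairwise_sort (z.2.1 : Multiset ℕ) (· ≤ ·)).sortedLE.monotone_get
        (a := ⟨j1 - 1, by omega⟩) (b := ⟨j2 - 1, by omega⟩) (by simp; omega)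
      simpa using this
  col_strict' := by
    intro i1 i2 j hi h
    have h1 : (i1, j) ∈ hook m n := (hook m n).up_left_mem hi.le le_rfl h
    have h' := mem_hook.1 h
    obtain ⟨rfl, h2⟩ : j = 0 ∧ i2 ≤ n := by omega
    simp only [h, h1, if_true, if_neg (show i2 ≠ 0 by omega)]
    split_ifs with h0
    · omega
    · have hl : (z.2.2.1.sort (· ≤ ·)).length = n := by simp [z.2.2.2]
      rw [List.getD_eq_getElem _ _ (by omega), List.getD_eq_getElem _ _ (by omega)]
      have := (Finset.sortedLT_sort z.2.2.1).strictMono_get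
        (a := ⟨i1 - 1, by omega⟩) (b := ⟨i2 - 1, by omega⟩) (by simp; omega)
      simpa using this
  zeros' := by
    intro i j h
    simp [h]

theorem hookTableau_apply {m n : ℕ} (z : ℕ × (Sym ℕ m × {s : Finset ℕ // s.card = n})) (i j : ℕ) :
    hookTableau m n z i j = if (i, j) ∈ hook m n then
      if i = 0 then
        if j = 0 then z.1 else z.1 + ((z.2.1 : Multiset ℕ).sort (· ≤ ·)).getD (j - 1) 0
      else z.1 + 1 + (z.2.2.1.sort (· ≤ ·)).getD (i - 1) 0
    else 0 := rfl

theorem hookTableau_corner {m n : ℕ} (z : ℕ × (Sym ℕ m × {s : Finset ℕ // s.card = n})) :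
    hookTableau m n z 0 0 = z.1 := by
  rw [hookTableau_apply, if_pos (mem_hook.2 (by omega)), if_pos rfl, if_pos rfl]

theorem hookTableau_row {m n : ℕ} (z : ℕ × (Sym ℕ m × {s : Finset ℕ // s.card = n})) {j : ℕ}
    (hj : j < m) :
    hookTableau m n z 0 (j + 1) = z.1 + ((z.2.1 : Multiset ℕ).sort (· ≤ ·)).getD j 0 := by
  rw [hookTableau_apply, if_pos (mem_hook.2 (by omega)), if_pos rfl, if_neg (by omega),
    Nat.add_sub_cancel]

theorem hookTableau_col {m n : ℕ} (z : ℕ × (Sym ℕ m × {s : Finset ℕ // s.card = n})) {i : ℕ}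
    (hi : i < n) :
    hookTableau m n z (i + 1) 0 = z.1 + 1 + (z.2.2.1.sort (· ≤ ·)).getD i 0 := by
  rw [hookTableau_apply, if_pos (mem_hook.2 (by omega)), if_neg (by omega), Nat.add_sub_cancel]

theorem hookTableau_bijective (m n : ℕ) : Function.Bijective (hookTableau m n) := by
  constructor
  · rintro ⟨c, s, t⟩ ⟨c', s', t'⟩ h
    have h0 : c = c' := by
      have := congrArg (fun T => T 0 0) h
      simpa only [hookTableau_corner] using this
    subst h0
    have hs : s = s' := by
      apply Sym.coe_injective
      rw [← Multiset.sort_eq (s : Multiset ℕ) (· ≤ ·), ← Multiset.sort_eq (s' : Multiset ℕ) (· ≤ ·)]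
      congr 1
      refine List.ext_getElem (by simp) fun j h1 h2 => ?_
      have hj : j < m := by simpa using h1
      have := congrArg (fun T => T 0 (j + 1)) h
      simp only [hookTableau_row _ hj] at this
      rw [List.getD_eq_getElem _ _ h1, List.getD_eq_getElem _ _ h2] at this
      omega
    have ht : t = t' := by
      apply Subtype.ext
      rw [← Finset.sort_toFinset t.1 (· ≤ ·), ← Finset.sort_toFinset t'.1 (· ≤ ·)]
      congr 1
      refine List.ext_getElem (by simp [t.2, t'.2]) fun j h1 h2 => ?_
      have hj : j < n := by simpa [t.2] using h1
      have := congrArg (fun T => T (j + 1) 0) h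
      simp only [hookTableau_col _ hj] at this
      rw [List.getD_eq_getElem _ _ h1, List.getD_eq_getElem _ _ h2] at this
      omega
    rw [hs, ht]
  · intro T
    -- The truncated subtractions in `ls` and `lt` are exact: by `hrow` and `hcol` the corner is at
    -- most every entry of the row and strictly below every entry of the column.
    set ls : List ℕ := List.ofFn fun j : Fin m => T 0 (j + 1) - T 0 0 with hls
    set lt : List ℕ := List.ofFn fun i : Fin n => T (i + 1) 0 - (T 0 0 + 1) with hlt
    have hrow : ∀ j < m, T 0 0 ≤ T 0 (j + 1) := fun j hj =>
      T.row_weak (by omega) (mem_hook.2 (by omega))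
    have hcol : ∀ i < n, T 0 0 < T (i + 1) 0 := fun i hi =>
      T.col_strict (by omega) (mem_hook.2 (by omega))
    have hs1 : ls.SortedLE := by
      rw [hls, List.sortedLE_ofFn_iff]
      intro a b hab
      have := T.row_weak_of_le (show (a : ℕ) + 1 ≤ b + 1 by simpa using hab)
        (mem_hook.2 (show (0 = 0 ∧ (b : ℕ) + 1 ≤ m) ∨ ((b : ℕ) + 1 = 0 ∧ 0 ≤ n) by omega))
      simp only
      omega
    have hs2 : lt.SortedLT := by
      rw [hlt, List.sortedLT_ofFn_iff]
      intro a b hab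
      have h1 := T.col_strict (show (a : ℕ) + 1 < b + 1 by simpa using hab)
        (mem_hook.2 (show ((b : ℕ) + 1 = 0 ∧ 0 ≤ m) ∨ (0 = 0 ∧ (b : ℕ) + 1 ≤ n) by omega))
      have h2 := hcol a a.2
      simp only
      omega
    refine ⟨(T 0 0, ⟨(ls : Multiset ℕ), by simp [hls]⟩, ⟨lt.toFinset, ?_⟩), ?_⟩
    · rw [List.toFinset_card_of_nodup hs2.nodup]
      simp [hlt]
    · have e1 : ((ls : Multiset ℕ)).sort (· ≤ ·) = ls :=
        List.Perm.eq_of_sortedLE (Multiset.pairwise_sort _ _).sortedLE hs1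
          (Multiset.coe_eq_coe.1 (Multiset.sort_eq _ _))
      have e2 : lt.toFinset.sort (· ≤ ·) = lt :=
        (List.toFinset_sort (· ≤ ·) hs2.nodup).2 hs2.sortedLE.pairwise
      ext i j
      rw [hookTableau_apply]
      split_ifs with h1 h2 h3
      · rw [h2, h3]
      · subst h2
        rw [mem_hook] at h1
        obtain ⟨j, rfl⟩ : ∃ j', j = j' + 1 := ⟨j - 1, by omega⟩
        have hj : j < m := by omega
        change T 0 0 + ((ls : Multiset ℕ).sort (· ≤ ·)).getD (j + 1 - 1) 0 = _
        rw [e1, Nat.add_sub_cancel, List.getD_eq_getElem _ _ (by simpa [hls] using hj)]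
        have := hrow j hj
        simp only [hls, List.getElem_ofFn]
        omega
      · rw [mem_hook] at h1
        obtain rfl : j = 0 := by omega
        obtain ⟨i, rfl⟩ : ∃ i', i = i' + 1 := ⟨i - 1, by omega⟩
        have hi : i < n := by omega
        simp only
        rw [e2, Nat.add_sub_cancel, List.getD_eq_getElem _ _ (by simpa [hlt] using hi)]
        have := hcol i hi
        simp only [hlt, List.getElem_ofFn]
        omega
      · exact (T.zeros h1).symm

theorem prod_hookTableau {K : Type*} [NormedField K] {x : ℕ → K} {c p : K}
    (hx : ∀ i, x i = c * p ^ i) {m n : ℕ} (z : ℕ × (Sym ℕ m × {s : Finset ℕ // s.card = n})) :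
    ∏ d ∈ (hook m n).cells, x (hookTableau m n z d.1 d.2) =
      (c * p ^ n * (p ^ (m + n + 1)) ^ z.1) *
        (((z.2.1 : Multiset ℕ).map x).prod * ∏ i ∈ z.2.2.1, x i) := by
  rw [prod_cells_hook, hookTableau_corner]
  have h1 : ((z.2.1 : Multiset ℕ).map x).prod =
      ∏ j ∈ Finset.range m, x (((z.2.1 : Multiset ℕ).sort (· ≤ ·)).getD j 0) := by
    conv_lhs => rw [← Multiset.sort_eq (z.2.1 : Multiset ℕ) (· ≤ ·)]
    rw [Multiset.map_coe, Multiset.prod_coe, prod_map_eq_prod_range_getD _ 0]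
    simp
  have h2 : ∏ i ∈ z.2.2.1, x i =
      ∏ j ∈ Finset.range n, x ((z.2.2.1.sort (· ≤ ·)).getD j 0) := by
    conv_lhs => rw [← Finset.sort_toFinset z.2.2.1 (· ≤ ·)]
    rw [List.prod_toFinset _ (Finset.sort_nodup _ _), prod_map_eq_prod_range_getD _ 0]
    simp [z.2.2.2]
  have h3 : ∏ j ∈ Finset.range m, x (hookTableau m n z 0 (j + 1)) =
      (p ^ z.1) ^ m * ∏ j ∈ Finset.range m, x (((z.2.1 : Multiset ℕ).sort (· ≤ ·)).getD j 0) := by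
    rw [show (p ^ z.1) ^ m = ∏ _j ∈ Finset.range m, p ^ z.1 by simp, ← Finset.prod_mul_distrib]
    refine Finset.prod_congr rfl fun j hj => ?_
    rw [hookTableau_row z (Finset.mem_range.1 hj), hx, hx]
    ring
  have h4 : ∏ j ∈ Finset.range n, x (hookTableau m n z (j + 1) 0) =
      (p ^ (z.1 + 1)) ^ n * ∏ j ∈ Finset.range n, x ((z.2.2.1.sort (· ≤ ·)).getD j 0) := by
    rw [show (p ^ (z.1 + 1)) ^ n = ∏ _j ∈ Finset.range n, p ^ (z.1 + 1) by simp,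
      ← Finset.prod_mul_distrib]
    refine Finset.prod_congr rfl fun j hj => ?_
    rw [hookTableau_col z (Finset.mem_range.1 hj), hx, hx]
    ring
  rw [h3, h4, ← h1, ← h2, hx]
  ring

variable {K : Type*} [NormedField K] [CompleteSpace K] {x : ℕ → K} {c p : K}

/-- Relative to the corner entry, the first row and the first column of a hook tableau are
independent: an arbitrary multiset and an arbitrary set. The corner runs over a geometric series of
ratio `p^(m+n+1)`, one factor `p` for each cell; the extra shift by one in the column gives `p^n`.
-/
theorem schur_hook (hp : ‖p‖ < 1) (hx : ∀ i, x i = c * p ^ i) (m n : ℕ) :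
    schur x (hook m n) =
      c * p ^ n / (1 - p ^ (m + n + 1)) * (completeSymm x m * elemSymm x n) := by
  have hg : Summable fun j : ℕ => ‖c * p ^ n * (p ^ (m + n + 1)) ^ j‖ := by
    simp_rw [norm_mul _ (_ ^ _), norm_pow (p ^ (m + n + 1))]
    exact (summable_geometric_of_lt_one (norm_nonneg _) (norm_pow_lt_one hp _)).mul_left _
  have h1 := summable_norm_completeSymm hp hx m
  have h2 := summable_norm_elemSymm hp hx n
  have h3 : schur x (hook m n) = ∑' z : ℕ × (Sym ℕ m × {s : Finset ℕ // s.card = n}),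
      (c * p ^ n * (p ^ (m + n + 1)) ^ z.1) *
        (((z.2.1 : Multiset ℕ).map x).prod * ∏ i ∈ z.2.2.1, x i) :=
    ((Equiv.ofBijective _ (hookTableau_bijective m n)).tsum_eq
      (fun T : SemistandardYoungTableau (hook m n) => ∏ d ∈ (hook m n).cells, x (T d.1 d.2))).symm.trans
      (tsum_congr fun z => prod_hookTableau hx z)
  have h4 : ∑' z : Sym ℕ m × {s : Finset ℕ // s.card = n},
      ((z.1 : Multiset ℕ).map x).prod * ∏ i ∈ z.2.1, x i = completeSymm x m * elemSymm x n :=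
    (tsum_mul_tsum_of_summable_norm h1 h2).symm
  have h5 := tsum_mul_tsum_of_summable_norm hg (Summable.mul_norm h1 h2)
  rw [tsum_mul_left, tsum_geometric_of_norm_lt_one (norm_pow_lt_one hp _), ← div_eq_mul_inv] at h5
  rw [h3, ← h4]
  exact h5.symm

end HookTableaux

/-! ### Closed forms at `q^ρ` -/

section Specialization

variable {K : Type*} [NormedField K]

theorem ne_zero_of_one_lt_norm {v : K} (hv : 1 < ‖v‖) : v ≠ 0 := by
  rintro rfl
  simp at hv
  linarith

theorem qRho_eq {v : K} (hv : v ≠ 0) (i : ℕ) :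
    qRho v i = v ^ (-6 : ℤ) * (v ^ (-12 : ℤ)) ^ i := by
  rw [qRho, ← zpow_natCast, ← zpow_mul, ← zpow_add₀ hv]
  congr 1
  ring

theorem norm_zpow_neg_twelve_lt_one {v : K} (hv : 1 < ‖v‖) : ‖v ^ (-12 : ℤ)‖ < 1 := by
  rw [norm_zpow]
  exact zpow_lt_one_of_neg₀ hv (by norm_num)

/-- Rewrites the denominators of the geometric series in terms of the symmetric quantum integers
`[n]`. -/
theorem one_sub_pow_eq {v : K} (hv : v ≠ 0) (n : ℕ) :
    1 - (v ^ (-12 : ℤ)) ^ n = v ^ (-(6 * (n : ℤ))) * qNum v n := by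
  rw [qNum, mul_sub, ← zpow_add₀ hv, ← zpow_add₀ hv, ← zpow_natCast, ← zpow_mul]
  have : -(6 * (n : ℤ)) + 6 * n = 0 := by ring
  rw [this, zpow_zero]
  congr 2
  ring

theorem qFact_succ (v : K) (n : ℕ) : qFact v (n + 1) = qFact v n * qNum v (n + 1) :=
  Finset.prod_range_succ _ _

variable [CompleteSpace K]

theorem elemSymm_qRho {v : K} (hv : 1 < ‖v‖) (n : ℕ) :
    elemSymm (qRho v) n = v ^ (-(3 * ((n : ℤ) * (n - 1)))) / qFact v n := by
  have h0 := ne_zero_of_one_lt_norm hv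
  induction n with
  | zero => simp [elemSymm_zero, qFact]
  | succ n ih =>
    have e : v ^ (-(3 * (((n + 1 : ℕ) : ℤ) * ((n + 1 : ℕ) - 1)))) =
        v ^ (-6 + -12 * (n : ℤ)) * v ^ (6 * ((n + 1 : ℕ) : ℤ)) *
          v ^ (-(3 * ((n : ℤ) * (n - 1)))) := by
      simp only [← zpow_add₀ h0]
      congr 1
      push_cast
      ring
    rw [elemSymm_succ (norm_zpow_neg_twelve_lt_one hv) (qRho_eq h0), ih, one_sub_pow_eq h0,
      qFact_succ, ← zpow_natCast, ← zpow_mul, ← zpow_add₀ h0, e, zpow_neg v (6 * _)]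
    generalize v ^ (-6 + -12 * (n : ℤ)) = w
    have := zpow_ne_zero (6 * ((n + 1 : ℕ) : ℤ)) h0
    field_simp

theorem completeSymm_qRho {v : K} (hv : 1 < ‖v‖) (n : ℕ) :
    completeSymm (qRho v) n = v ^ (3 * ((n : ℤ) * (n - 1))) / qFact v n := by
  have h0 := ne_zero_of_one_lt_norm hv
  induction n with
  | zero => simp [completeSymm_zero, qFact]
  | succ n ih =>
    rw [completeSymm_succ (norm_zpow_neg_twelve_lt_one hv) (qRho_eq h0), ih, one_sub_pow_eq h0, qFact_succ,
      show (3 * (((n + 1 : ℕ) : ℤ) * ((n + 1 : ℕ) - 1))) =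
        -6 + 6 * ((n + 1 : ℕ) : ℤ) + 3 * ((n : ℤ) * (n - 1)) by push_cast; ring,
      zpow_add₀ h0, zpow_add₀ h0, zpow_neg v (6 * _)]
    have := zpow_ne_zero (6 * ((n + 1 : ℕ) : ℤ)) h0
    field_simp

theorem sBar_eq {v : K} (hv : 1 < ‖v‖) (m n : ℕ) :
    sBar v m n = v ^ (3 * ((m : ℤ) * (m + 1) - (n : ℤ) * (n + 1))) /
      (qNum v (m + n + 1) * qFact v m * qFact v n) := by
  have h0 := ne_zero_of_one_lt_norm hv
  have e : v ^ (3 * ((m : ℤ) * (m + 1) - (n : ℤ) * (n + 1))) =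
      v ^ (-6 + -12 * (n : ℤ)) * v ^ (6 * ((m + n + 1 : ℕ) : ℤ)) * v ^ (3 * ((m : ℤ) * (m - 1))) *
        v ^ (-(3 * ((n : ℤ) * (n - 1)))) := by
    simp only [← zpow_add₀ h0]
    congr 1
    push_cast
    ring
  rw [sBar, schur_hook (norm_zpow_neg_twelve_lt_one hv) (qRho_eq h0), one_sub_pow_eq h0,
    elemSymm_qRho hv, completeSymm_qRho hv, ← zpow_natCast, ← zpow_mul, ← zpow_add₀ h0, e,
    zpow_neg v (6 * _)]
  generalize v ^ (-6 + -12 * (n : ℤ)) = w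
  have := zpow_ne_zero (6 * ((m + n + 1 : ℕ) : ℤ)) h0
  field_simp

theorem eBar_sub {v : K} (hv : 1 < ‖v‖) {m l : ℕ} (h : l ≤ m) :
    eBar v ((m : ℤ) - l) = v ^ (-(3 * (((m : ℤ) - l) * (m - l - 1)))) / qFact v (m - l) := by
  rw [← Nat.cast_sub h]
  exact elemSymm_qRho hv _

theorem hBar_sub {v : K} (hv : 1 < ‖v‖) {m l : ℕ} (h : l ≤ m) :
    hBar v ((m : ℤ) - l) = v ^ (3 * (((m : ℤ) - l) * (m - l - 1))) / qFact v (m - l) := by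
  rw [← Nat.cast_sub h]
  exact completeSymm_qRho hv _

end Specialization

/-! ### Cyclic indices and the factorization of the framed coefficients -/

section CyclicIndices

theorem eq_or_eq_add_one_or_eq_add_two (i j : Fin 3) : j = i ∨ j = i + 1 ∨ j = i + 2 := by
  revert i j; decide

theorem self_ne_add_one (i : Fin 3) : i ≠ i + 1 := by revert i; decide

theorem self_ne_add_two (i : Fin 3) : i ≠ i + 2 := by revert i; decide

theorem add_one_ne_add_two (i : Fin 3) : i + 1 ≠ i + 2 := by revert i; decide

theorem add_one_add_two (i : Fin 3) : i + 1 + 2 = i := by revert i; decide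

theorem add_two_add_one (i : Fin 3) : i + 2 + 1 = i := by revert i; decide

end CyclicIndices

section Factorization

variable {K : Type*} [NormedField K]

theorem eBar_of_neg (v : K) {k : ℤ} (hk : k < 0) : eBar v k = 0 := by
  obtain ⟨n, rfl⟩ := Int.eq_negSucc_of_lt_zero hk
  rfl

theorem hBar_of_neg (v : K) {k : ℤ} (hk : k < 0) : hBar v k = 0 := by
  obtain ⟨n, rfl⟩ := Int.eq_negSucc_of_lt_zero hk
  rfl

/-- The entry in row `m` of the `l`-th bordering column attached to the pair `(i, j)`. -/
noncomputable def colEntry (v : K) (i j : Fin 3) (m l : ℕ) : K :=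
  if j = i + 1 then v ^ (6 * ((m : ℤ) * (m + 1))) * eBar v ((m : ℤ) - l)
  else if j = i + 2 then hBar v ((m : ℤ) - l) else 0

/-- The entry in column `n` of the `l`-th bordering row attached to the pair `(i, j)`. -/
noncomputable def rowEntry (v : K) (i j : Fin 3) (n l : ℕ) : K :=
  if j = i + 1 then eBar v ((n : ℤ) - l)
  else if j = i + 2 then v ^ (-(6 * ((n : ℤ) * (n + 1)))) * hBar v ((n : ℤ) - l) else 0

/-- The coefficient attached to the pair `(i, j)`. -/
def coupling (v : K) (i j : Fin 3) : K :=
  if j = i + 1 then v ^ (2 : ℤ) else if j = i + 2 then -v ^ (-2 : ℤ) else 0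

theorem colEntry_of_lt (v : K) (i j : Fin 3) {m l : ℕ} (h : m < l) : colEntry v i j m l = 0 := by
  unfold colEntry
  rw [eBar_of_neg v (by omega), hBar_of_neg v (by omega)]
  simp

theorem rowEntry_of_lt (v : K) (i j : Fin 3) {n l : ℕ} (h : n < l) : rowEntry v i j n l = 0 := by
  unfold rowEntry
  rw [eBar_of_neg v (by omega), hBar_of_neg v (by omega)]
  simp

/-- The coefficients `A^{ij}_{mn}` with their monomial prefactors removed. -/
noncomputable def coreEntry (v : K) (N : ℕ) (i j : Fin 3) (m n : ℕ) : K :=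
  (if j = i then sBar v m n else 0) +
    ∑ l : Fin N, coupling v i j * colEntry v i j m l * rowEntry v i j n l

/-- The summands with `l > min m n` vanish, so every cutoff `N > m` gives the same sum. One `N` can
then serve all entries of the matrix. -/
theorem sum_colEntry_mul_rowEntry (v : K) (i j : Fin 3) {m n N : ℕ} (hm : m < N) :
    ∑ l : Fin N, coupling v i j * colEntry v i j m l * rowEntry v i j n l =
      ∑ l ∈ Finset.range (min m n + 1), coupling v i j * colEntry v i j m l * rowEntry v i j n l := by
  rw [Fin.sum_univ_eq_sum_range
    (fun l => coupling v i j * colEntry v i j m l * rowEntry v i j n l) N]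
  symm
  refine Finset.sum_subset (Finset.range_subset_range.2 (by omega)) fun l _ hl => ?_
  rw [Finset.mem_range, not_lt] at hl
  rcases lt_or_ge m l with h | h
  · rw [colEntry_of_lt v i j h, mul_zero, zero_mul]
  · rw [rowEntry_of_lt v i j (by omega : n < l), mul_zero]

variable [CompleteSpace K]

/-- On the diagonal this is `sBar_eq`. Off the diagonal, the exponent `(l+1)(m+n-l)` has no `mn`
term, so each summand splits into a function of `(m, l)` times a function of `(n, l)`. Completing
the squares identifies these with `e` or `h` values at `m - l` and `n - l`. -/
theorem framedCoeff_eq {v : K} (hv : 1 < ‖v‖) (a : Fin 3 → ℤ) (i j : Fin 3) {m n N : ℕ}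
    (hm : m < N) :
    framedCoeff v a i j m n =
      v ^ (6 * (a i * ((m : ℤ) * (m + 1)))) *
        ((-1) ^ n * v ^ (-(6 * (a j * ((n : ℤ) * (n + 1))))) * coreEntry v N i j m n) := by
  have h0 := ne_zero_of_one_lt_norm hv
  rw [coreEntry, sum_colEntry_mul_rowEntry v i j hm]
  have e1 : i ≠ i + 1 := self_ne_add_one i
  have e2 : i ≠ i + 2 := self_ne_add_two i
  have e5 : i + 2 ≠ i + 1 := (add_one_ne_add_two i).symm
  rcases eq_or_eq_add_one_or_eq_add_two i j with rfl | rfl | rfl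
  · rw [framedCoeff, if_pos rfl, if_pos rfl, sBar_eq hv]
    simp only [coupling, if_neg e1, if_neg e2, zero_mul, Finset.sum_const_zero, add_zero]
    rw [show 3 * ((2 * a j + 1) * ((m : ℤ) * (m + 1) - (n : ℤ) * (n + 1))) =
      6 * (a j * ((m : ℤ) * (m + 1))) + -(6 * (a j * ((n : ℤ) * (n + 1)))) +
        3 * ((m : ℤ) * (m + 1) - (n : ℤ) * (n + 1)) by ring, zpow_add₀ h0, zpow_add₀ h0]
    ring
  · rw [framedCoeff, if_neg e1.symm, if_pos rfl, if_neg e1.symm, zero_add, Finset.mul_sum, Finset.mul_sum,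
      Finset.mul_sum]
    refine Finset.sum_congr rfl fun l hl => ?_
    rw [Finset.mem_range] at hl
    simp only [coupling, colEntry, rowEntry, if_true]
    rw [eBar_sub hv (show l ≤ m by omega), eBar_sub hv (show l ≤ n by omega)]
    -- The factorials already agree on both sides; what remains is an identity of exponents of `v`.
    have : v ^ (3 * ((2 * a i + 1) * ((m : ℤ) * (m + 1)) - (2 * a (i + 1) + 1) * ((n : ℤ) * (n + 1)))
        + 2) * v ^ (6 * (((l : ℤ) + 1) * (m + n - l))) =
      v ^ (6 * (a i * ((m : ℤ) * (m + 1)))) * v ^ (-(6 * (a (i + 1) * ((n : ℤ) * (n + 1))))) *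
        v ^ (2 : ℤ) * v ^ (6 * ((m : ℤ) * (m + 1))) * v ^ (-(3 * (((m : ℤ) - l) * (m - l - 1)))) *
        v ^ (-(3 * (((n : ℤ) - l) * (n - l - 1)))) := by
      simp only [← zpow_add₀ h0]
      congr 1
      ring
    linear_combination (-1) ^ n / (qFact v (m - l) * qFact v (n - l)) * this
  · rw [framedCoeff, if_neg e2.symm, if_neg e5, if_neg e2.symm, zero_add, Finset.mul_sum, Finset.mul_sum,
      Finset.mul_sum]
    refine Finset.sum_congr rfl fun l hl => ?_
    rw [Finset.mem_range] at hl
    simp only [coupling, colEntry, rowEntry, if_true, if_neg e5]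
    rw [hBar_sub hv (show l ≤ m by omega), hBar_sub hv (show l ≤ n by omega)]
    have : v ^ (3 * ((2 * a i + 1) * ((m : ℤ) * (m + 1)) - (2 * a (i + 2) + 1) * ((n : ℤ) * (n + 1)))
        - 2) * v ^ (-(6 * (((l : ℤ) + 1) * (m + n - l)))) =
      v ^ (6 * (a i * ((m : ℤ) * (m + 1)))) * v ^ (-(6 * (a (i + 2) * ((n : ℤ) * (n + 1))))) *
        v ^ (-2 : ℤ) * v ^ (3 * (((m : ℤ) - l) * (m - l - 1))) *
        v ^ (-(6 * ((n : ℤ) * (n + 1)))) * v ^ (3 * (((n : ℤ) - l) * (n - l - 1))) := by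
      simp only [← zpow_add₀ h0]
      congr 1
      ring
    linear_combination -(-1) ^ n / (qFact v (m - l) * qFact v (n - l)) * this

end Factorization

/-! ### Admissible sets and the anticommutation of the fermions -/

namespace Admissible

theorem finite_above (A : Admissible) (r : ℤ) : {a ∈ A.1 | r < a}.Finite := by
  refine (A.2.2.union (Set.finite_Ioo r 0)).subset ?_
  rintro a ⟨ha, hr⟩
  by_cases h : a < 0
  · exact Or.inr ⟨hr, h⟩
  · exact Or.inl ⟨ha, h⟩

theorem mem_add {A : Admissible} {r s : ℤ} : r ∈ (A.add s).1 ↔ r = s ∨ r ∈ A.1 := Iff.rfl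

theorem mem_remove {A : Admissible} {r s : ℤ} : r ∈ (A.remove s).1 ↔ r ∈ A.1 ∧ r ≠ s := Iff.rfl

theorem ext_mem {A B : Admissible} (h : ∀ r, r ∈ A.1 ↔ r ∈ B.1) : A = B :=
  Subtype.ext (Set.ext h)

theorem above_add {A : Admissible} {s : ℤ} (hs : s ∉ A.1) (r : ℤ) :
    (A.add s).above r = A.above r + if r < s then 1 else 0 := by
  unfold above
  split_ifs with h
  · have : {a ∈ (A.add s).1 | r < a} = insert s {a ∈ A.1 | r < a} := by
      ext a
      simp only [Set.mem_ofPred_eq, Set.mem_insert_iff, mem_add]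
      constructor
      · tauto
      · rintro (rfl | h') <;> tauto
    rw [this, Set.ncard_insert_of_notMem (fun h' => hs h'.1) (A.finite_above r)]
  · congr 1
    ext a
    simp only [Set.mem_ofPred_eq, mem_add]
    constructor
    · rintro ⟨rfl | h', h2⟩ <;> tauto
    · tauto

theorem add_remove {A : Admissible} {s : ℤ} (hs : s ∈ A.1) : (A.remove s).add s = A := by
  refine ext_mem fun r => ?_
  rw [mem_add, mem_remove]
  constructor
  · rintro (rfl | h) <;> tauto
  · tauto

theorem above_remove {A : Admissible} {s : ℤ} (hs : s ∈ A.1) (r : ℤ) :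
    A.above r = (A.remove s).above r + if r < s then 1 else 0 := by
  conv_lhs => rw [← add_remove hs]
  exact above_add (fun h => (mem_remove.1 h).2 rfl) r

theorem charge_add {A : Admissible} {s : ℤ} (hs : s ∉ A.1) : (A.add s).charge = A.charge + 1 := by
  unfold charge
  by_cases h : s < 0
  · have h1 : (A.add s).1 \ Set.Iio 0 = A.1 \ Set.Iio 0 := by
      ext a
      simp only [Set.mem_sdiff, mem_add, Set.mem_Iio]
      constructor
      · rintro ⟨rfl | h1, h2⟩ <;> tauto
      · tauto
    have h2 : Set.Iio 0 \ A.1 = insert s (Set.Iio 0 \ (A.add s).1) := by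
      ext a
      simp only [Set.mem_sdiff, mem_add, Set.mem_Iio, Set.mem_insert_iff]
      constructor
      · tauto
      · rintro (rfl | h1) <;> tauto
    rw [h1, h2, Set.ncard_insert_of_notMem (fun h' => h'.2 (Or.inl rfl)) (A.add s).2.1]
    push_cast
    ring
  · have h1 : (A.add s).1 \ Set.Iio 0 = insert s (A.1 \ Set.Iio 0) := by
      ext a
      simp only [Set.mem_sdiff, mem_add, Set.mem_Iio, Set.mem_insert_iff]
      constructor
      · tauto
      · rintro (rfl | h1) <;> tauto
    have h2 : Set.Iio 0 \ (A.add s).1 = Set.Iio 0 \ A.1 := by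
      ext a
      simp only [Set.mem_sdiff, mem_add, Set.mem_Iio]
      constructor
      · tauto
      · rintro ⟨h1, h2⟩
        refine ⟨h1, ?_⟩
        rintro (rfl | h3) <;> tauto
    rw [h1, h2, Set.ncard_insert_of_notMem (fun h' => hs h'.1) A.2.2]
    push_cast
    ring

theorem charge_remove {A : Admissible} {s : ℤ} (hs : s ∈ A.1) :
    A.charge = (A.remove s).charge + 1 := by
  conv_lhs => rw [← add_remove hs]
  exact charge_add fun h => (mem_remove.1 h).2 rfl

end Admissible

section Operators

variable {K : Type*} [Field K]

theorem fock_end_ext {S T : Module.End K (Fock K)} (h : ∀ A, S (ket K A) = T (ket K A)) : S = T :=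
  Finsupp.basisSingleOne.ext fun A => by simpa using h A

open Classical in
theorem psi_ket (r : ℤ) (A : Admissible) :
    psi K r (ket K A) = if r ∈ A.1 then 0 else (-1 : K) ^ A.above r • ket K (A.add r) := by
  rw [psi, Finsupp.linearCombination_single, one_smul]

open Classical in
theorem psiStar_ket (r : ℤ) (A : Admissible) :
    psiStar K r (ket K A) = if r ∈ A.1 then (-1 : K) ^ A.above r • ket K (A.remove r) else 0 := by
  rw [psiStar, Finsupp.linearCombination_single, one_smul]

theorem parity_ket (A : Admissible) : parity K (ket K A) = (-1 : K) ^ A.charge • ket K A := by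
  rw [parity, Finsupp.linearCombination_single, one_smul]

theorem neg_one_pow_ite_lt {r s : ℤ} (h : r ≠ s) :
    (-1 : K) ^ (if r < s then 1 else 0) = -(-1 : K) ^ (if s < r then 1 else 0) := by
  rcases lt_or_gt_of_ne h with h' | h'
  · rw [if_pos h', if_neg (not_lt.2 h'.le)]; simp
  · rw [if_pos h', if_neg (not_lt.2 h'.le)]; simp

theorem psi_mul_psi (r s : ℤ) : psi K r * psi K s = (-1 : K) • (psi K s * psi K r) := by
  refine fock_end_ext fun A => ?_
  simp only [Module.End.mul_apply, LinearMap.smul_apply, psi_ket]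
  by_cases hr : r ∈ A.1 <;> by_cases hs : s ∈ A.1 <;>
    simp only [hr, hs, if_true, if_false, map_zero, map_smul, psi_ket,
      Admissible.mem_add, or_true, smul_zero, or_false]
  by_cases h : r = s
  · subst h; simp
  · rw [if_neg h, if_neg (Ne.symm h), Admissible.above_add hr, Admissible.above_add hs, pow_add,
      pow_add, neg_one_pow_ite_lt h,
      show (A.add s).add r = (A.add r).add s from Admissible.ext_mem fun x => by
        simp only [Admissible.mem_add]; tauto, smul_smul, smul_smul, smul_smul]
    congr 1
    ring

theorem psiStar_mul_psiStar (r s : ℤ) : 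
    psiStar K r * psiStar K s = (-1 : K) • (psiStar K s * psiStar K r) := by
  refine fock_end_ext fun A => ?_
  simp only [Module.End.mul_apply, LinearMap.smul_apply, psiStar_ket]
  by_cases hr : r ∈ A.1 <;> by_cases hs : s ∈ A.1 <;>
    simp only [hr, hs, if_true, if_false, map_zero, map_smul, psiStar_ket,
      Admissible.mem_remove, false_and, smul_zero, true_and]
  by_cases h : r = s
  · subst h; simp
  · rw [if_pos h, if_pos (Ne.symm h), Admissible.above_remove hr, Admissible.above_remove hs, pow_add,
      pow_add, neg_one_pow_ite_lt h,
      show (A.remove s).remove r = (A.remove r).remove s from Admissible.ext_mem fun x => by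
        simp only [Admissible.mem_remove]; tauto, smul_smul, smul_smul, smul_smul]
    congr 1
    ring

theorem psi_mul_psiStar {r s : ℤ} (h : r ≠ s) : 
    psi K r * psiStar K s = (-1 : K) • (psiStar K s * psi K r) := by
  refine fock_end_ext fun A => ?_
  simp only [Module.End.mul_apply, LinearMap.smul_apply, psi_ket, psiStar_ket]
  by_cases hr : r ∈ A.1 <;> by_cases hs : s ∈ A.1 <;>
    simp only [hr, hs, if_true, if_false, map_zero, map_smul, psi_ket, psiStar_ket,
      Admissible.mem_add, Admissible.mem_remove, h, h.symm, ne_eq, not_false_eq_true, and_self,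
      false_and, or_true, or_self, smul_zero]
  rw [Admissible.above_add hr, Admissible.above_remove hs r, pow_add,
      pow_add,
      show (A.remove s).add r = (A.add r).remove s from Admissible.ext_mem fun x => by
        simp only [Admissible.mem_remove, Admissible.mem_add]
        constructor
        · rintro (rfl | h') <;> tauto
        · tauto, smul_smul, smul_smul, smul_smul]
  congr 1
  split_ifs with h1 h2 h2 <;> first | omega | (simp only [pow_zero, pow_one]; ring)

theorem neg_one_zpow_add_one (k : ℤ) : (-1 : K) ^ (k + 1) = -(-1 : K) ^ k := by
  rw [zpow_add₀ (by simp)]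
  simp

theorem parity_mul_psi (r : ℤ) : parity K * psi K r = (-1 : K) • (psi K r * parity K) := by
  refine fock_end_ext fun A => ?_
  simp only [Module.End.mul_apply, LinearMap.smul_apply, psi_ket, parity_ket, map_smul]
  split_ifs with h
  · simp
  · rw [map_smul, parity_ket, Admissible.charge_add h, neg_one_zpow_add_one, smul_smul, smul_smul,
      smul_smul]
    congr 1
    ring

theorem parity_mul_psiStar (r : ℤ) : parity K * psiStar K r = (-1 : K) • (psiStar K r * parity K) := by
  refine fock_end_ext fun A => ?_
  simp only [Module.End.mul_apply, LinearMap.smul_apply, psiStar_ket, parity_ket, map_smul]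
  split_ifs with h
  · rw [map_smul, parity_ket, Admissible.charge_remove h, neg_one_zpow_add_one, smul_smul, smul_smul,
      smul_smul]
    congr 1
    ring
  · simp

theorem parity_mul_parity : parity K * parity K = 1 := by
  refine fock_end_ext fun A => ?_
  rw [Module.End.mul_apply, parity_ket, map_smul, parity_ket, smul_smul, ← mul_zpow]
  simp

/-- In distinct factors the sign arises where the parity inserted by the operator further right
meets the odd operator further left. In the same factor the parities to the left occur equally in
both orders, and the sign is supplied by `h`. -/
theorem onFactor_mul_onFactor {S T : Module.End K (Fock K)} 
    (hS : parity K * S = (-1 : K) • (S * parity K)) (hT : parity K * T = (-1 : K) • (T * parity K))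
    (i j : Fin 3) (h : i = j → S * T = (-1 : K) • (T * S)) :
    onFactor K i S * onFactor K j T = (-1 : K) • (onFactor K j T * onFactor K i S) := by
  have hS' : S * parity K = (-1 : K) • (parity K * S) := by rw [hS, smul_smul]; simp
  have hPP := parity_mul_parity (K := K)
  fin_cases i <;> fin_cases j <;>
    simp only [onFactor, ← TensorProduct.map_mul, ← Module.End.one_eq_id, one_mul, mul_one]
  · rw [h rfl, TensorProduct.map_smul_left]
  · rw [hS', TensorProduct.map_smul_left]
  · rw [hS', TensorProduct.map_smul_left]
  · rw [hT, TensorProduct.map_smul_left]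
  · rw [h rfl, TensorProduct.map_smul_left, TensorProduct.map_smul_right]
  · rw [hS', TensorProduct.map_smul_left, TensorProduct.map_smul_right]
  · rw [hT, TensorProduct.map_smul_left]
  · rw [hT, TensorProduct.map_smul_left, TensorProduct.map_smul_right]
  · rw [h rfl, TensorProduct.map_smul_right, TensorProduct.map_smul_right]

/-- The operator `ψ^i_{m + 1/2}`. -/
noncomputable def creator (K : Type*) [Field K] (x : Fin 3 × ℕ) : Module.End K (Fock3 K) :=
  onFactor K x.1 (psi K (x.2 : ℤ))

/-- The operator `ψ^{i*}_{-n - 1/2}`. -/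
noncomputable def annihilator (K : Type*) [Field K] (x : Fin 3 × ℕ) : Module.End K (Fock3 K) :=
  onFactor K x.1 (psiStar K (-(x.2 : ℤ) - 1))

theorem creator_mul_creator (x y : Fin 3 × ℕ) :
    creator K x * creator K y = (-1 : K) • (creator K y * creator K x) :=
  onFactor_mul_onFactor (parity_mul_psi _) (parity_mul_psi _) _ _ fun _ => psi_mul_psi _ _

theorem annihilator_mul_annihilator (x y : Fin 3 × ℕ) :
    annihilator K x * annihilator K y = (-1 : K) • (annihilator K y * annihilator K x) :=
  onFactor_mul_onFactor (parity_mul_psiStar _) (parity_mul_psiStar _) _ _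
    fun _ => psiStar_mul_psiStar _ _

/-- No scalar term appears: the creator has mode `≥ 0` and the annihilator mode `< 0`, so the two
modes are never equal. -/
theorem annihilator_mul_creator (x y : Fin 3 × ℕ) :
    annihilator K x * creator K y = (-1 : K) • (creator K y * annihilator K x) := by
  have h : creator K y * annihilator K x = (-1 : K) • (annihilator K x * creator K y) :=
    onFactor_mul_onFactor (parity_mul_psi _) (parity_mul_psiStar _) _ _
      fun _ => psi_mul_psiStar (by omega)
  rw [h, smul_smul]
  simp

end Operators

/-! ### Reordering products of anticommuting elements -/

section Anticommuting

variable {K R ι : Type*} [Field K] [CharZero K] [Semiring R] [Algebra K R]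

/-- The sign is that of an alternating map. Linear combinations of the `X x` anticommute, hence
square to zero because 2 is invertible. So `X` extends to the exterior algebra of the free module on
`ι`, and the product is the image of a wedge of basis vectors. -/
theorem prod_ofFn_comp_perm {X : ι → R} (hX : ∀ x y, X x * X y = (-1 : K) • (X y * X x)) {k : ℕ}
    (p : Fin k → ι) (σ : Equiv.Perm (Fin k)) :
    (List.ofFn fun t => X (p (σ t))).prod = 
      ((Equiv.Perm.sign σ : ℤ) : K) • (List.ofFn fun t => X (p t)).prod := by
  let f : (ι →₀ K) →ₗ[K] R := Finsupp.linearCombination K X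
  have hf : ∀ m m', f m * f m' = (-1 : K) • (f m' * f m) := by
    intro m m'
    induction m using Finsupp.induction_linear with
    | zero => simp
    | add a b ha hb => rw [map_add, add_mul, mul_add, ha, hb, smul_add]
    | single x c =>
      induction m' using Finsupp.induction_linear with
      | zero => simp
      | add a b ha hb => rw [map_add, add_mul, mul_add, ha, hb, smul_add]
      | single y d =>
        simp only [f, Finsupp.linearCombination_single, smul_mul_smul_comm]
        rw [hX, smul_comm, mul_comm]
  have hf0 : ∀ m, f m * f m = 0 := by
    intro m
    have h : (2 : K) • (f m * f m) = 0 := by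
      rw [← one_add_one_eq_two, add_smul, one_smul]
      nth_rw 1 [hf m m]
      nth_rw 2 [← one_smul K (f m * f m)]
      rw [← add_smul, neg_add_cancel, zero_smul]
    rw [← one_smul K (f m * f m), ← inv_mul_cancel₀ (two_ne_zero (α := K)), mul_smul, h, smul_zero]
  have key : ∀ q : Fin k → ι, (List.ofFn fun t => X (q t)).prod =
      ExteriorAlgebra.lift K ⟨f, hf0⟩
        (ExteriorAlgebra.ιMulti K k fun t => Finsupp.single (q t) (1 : K)) := by
    intro q
    rw [ExteriorAlgebra.ιMulti_apply, map_list_prod, List.map_ofFn]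
    congr 2
    funext t
    simp [f]
  rw [key, key]
  have := (ExteriorAlgebra.ιMulti K k).map_perm (fun t => Finsupp.single (p t) (1 : K)) σ
  simp only [Function.comp_def] at this
  rw [this, Units.smul_def, ← Int.cast_smul_eq_zsmul K, map_smul]

/-- Each `Y` has to pass the `X` of every later pair, which costs one sign for each pair of
positions. -/
theorem prod_map_mul_eq {K R α : Type*} [Field K] [Semiring R] [Algebra K R] {X Y : α → R}
    (hYX : ∀ x y, Y x * X y = (-1 : K) • (X y * Y x)) (w : List α) :
    (w.map fun x => X x * Y x).prod =
      (-1 : K) ^ w.length.choose 2 • ((w.map X).prod * (w.map Y).prod) := by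
  have comm : ∀ (y : α) (w : List α),
      Y y * (w.map X).prod = (-1 : K) ^ w.length • ((w.map X).prod * Y y) := by
    intro y w
    induction w with
    | nil => simp
    | cons a w ih =>
      rw [List.map_cons, List.prod_cons, ← mul_assoc, hYX, smul_mul_assoc, mul_assoc, ih,
        List.length_cons, pow_succ, mul_smul_comm, smul_smul, mul_comm (-1 : K), mul_assoc (X a)]
  induction w with
  | nil => simp
  | cons a w ih =>
    simp only [List.map_cons, List.prod_cons, List.length_cons]
    rw [ih, Nat.choose_succ_succ' w.length 1, Nat.choose_one_right, pow_add, mul_smul_comm, mul_comm,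
      mul_smul, mul_assoc, ← mul_assoc (Y a), comm, smul_mul_assoc, mul_smul_comm, mul_assoc, mul_assoc]

/-- Separating the `X` from the `Y` costs the same sign `(-1)^(k choose 2)` before and after the
permutations, so only the two permutation signs survive. -/
theorem prod_ofFn_mul_comp_perm {X Y : ι → R} (hX : ∀ x y, X x * X y = (-1 : K) • (X y * X x))
    (hY : ∀ x y, Y x * Y y = (-1 : K) • (Y y * Y x)) (hYX : ∀ x y, Y x * X y = (-1 : K) • (X y * Y x)) {k : ℕ}
    (p q : Fin k → ι) (α β : Equiv.Perm (Fin k)) :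
    (List.ofFn fun t => X (p (α t)) * Y (q (β t))).prod =
      ((Equiv.Perm.sign α : ℤ) * (Equiv.Perm.sign β : ℤ) : K) •
        (List.ofFn fun t => X (p t) * Y (q t)).prod := by
  have key : ∀ p q : Fin k → ι, (List.ofFn fun t => X (p t) * Y (q t)).prod =
      (-1 : K) ^ k.choose 2 •
        ((List.ofFn fun t => X (p t)).prod * (List.ofFn fun t => Y (q t)).prod) := by
    intro p q
    have := prod_map_mul_eq (K := K) (X := fun t => X (p t)) (Y := fun t => Y (q t))
      (fun x y => hYX (q x) (p y)) (List.finRange k)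
    simpa only [List.ofFn_eq_map, List.length_finRange] using this
  rw [key (fun t => p (α t)) (fun t => q (β t)), key p q, prod_ofFn_comp_perm (K := K) hX p α,
    prod_ofFn_comp_perm (K := K) hY q β, smul_mul_smul_comm, smul_comm]

end Anticommuting

/-! ### Frobenius coordinates and the sets `A_μ` -/

section Frobenius

variable (μ : YoungDiagram)

/-- The diagonal cells form an initial segment, which is determined by its cardinality. -/
theorem lt_diagLen {t : ℕ} : t < diagLen μ ↔ (t, t) ∈ μ := by
  set D := (μ.cells.filter fun c => c.1 = c.2).image Prod.fst with hD
  have hmem : ∀ s, s ∈ D ↔ (s, s) ∈ μ := by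
    intro s
    simp only [hD, Finset.mem_image, Finset.mem_filter, YoungDiagram.mem_cells, Prod.exists]
    constructor
    · rintro ⟨a, b, ⟨h1, rfl⟩, rfl⟩
      exact h1
    · exact fun h => ⟨s, s, ⟨h, rfl⟩, rfl⟩
  have hcard : D.card = diagLen μ := by
    rw [hD, Finset.card_image_of_injOn, diagLen]
    rintro ⟨a, b⟩ hx ⟨c, d⟩ hy hxy
    simp only [Finset.coe_filter, Set.mem_ofPred_eq] at hx hy hxy
    rw [← hx.2, ← hy.2, hxy]
  have hrange : D = Finset.range (diagLen μ) := by
    rw [← hcard]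
    symm
    refine Finset.eq_of_subset_of_card_le (fun s hs => ?_) (by simp)
    by_contra hs'
    have hsub : D ⊆ Finset.range s := fun u hu => by
      rw [Finset.mem_range]
      by_contra hlt
      exact hs' ((hmem s).2 (μ.up_left_mem (not_lt.1 hlt) (not_lt.1 hlt) ((hmem u).1 hu)))
    have := Finset.card_le_card hsub
    rw [Finset.card_range] at this
    rw [Finset.mem_range] at hs
    omega
  rw [← hmem, hrange, Finset.mem_range]

variable {μ}

theorem arm_eq {t : ℕ} (ht : t < diagLen μ) : (arm μ t : ℤ) = (μ.rowLen t : ℤ) - (t + 1) := by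
  have := YoungDiagram.mem_iff_lt_rowLen.1 ((lt_diagLen μ).1 ht)
  unfold arm
  omega

theorem leg_eq {t : ℕ} (ht : t < diagLen μ) : (leg μ t : ℤ) = (μ.colLen t : ℤ) - (t + 1) := by
  have := YoungDiagram.mem_iff_lt_colLen.1 ((lt_diagLen μ).1 ht)
  unfold leg
  omega

theorem arm_lt_arm {s t : ℕ} (hst : s < t) (ht : t < diagLen μ) : arm μ t < arm μ s := by
  have h1 := arm_eq ht
  have h2 := arm_eq (hst.trans ht)
  have h3 := μ.rowLen_anti s t hst.le
  omega

theorem leg_lt_leg {s t : ℕ} (hst : s < t) (ht : t < diagLen μ) : leg μ t < leg μ s := by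
  have h1 := leg_eq ht
  have h2 := leg_eq (hst.trans ht)
  have h3 := μ.colLen_anti s t hst.le
  omega

theorem arm_injective {s t : ℕ} (hs : s < diagLen μ) (ht : t < diagLen μ) (h : arm μ s = arm μ t) :
    s = t := by
  rcases lt_trichotomy s t with h1 | h1 | h1
  · have := arm_lt_arm h1 ht; omega
  · exact h1
  · have := arm_lt_arm h1 hs; omega

theorem leg_injective {s t : ℕ} (hs : s < diagLen μ) (ht : t < diagLen μ) (h : leg μ s = leg μ t) :
    s = t := by
  rcases lt_trichotomy s t with h1 | h1 | h1
  · have := leg_lt_leg h1 ht; omega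
  · exact h1
  · have := leg_lt_leg h1 hs; omega

/-- The numbers `μ_t - t - 1` and `j - μᵗ_j` are distinct. -/
theorem rowLen_sub_ne (μ : YoungDiagram) (t j : ℕ) :
    (μ.rowLen t : ℤ) - (t + 1) ≠ (j : ℤ) - μ.colLen j := by
  by_cases h : (t, j) ∈ μ
  · have h1 := YoungDiagram.mem_iff_lt_rowLen.1 h
    have h2 := YoungDiagram.mem_iff_lt_colLen.1 h
    omega
  · have h1 := mt YoungDiagram.mem_iff_lt_rowLen.2 h
    have h2 := mt YoungDiagram.mem_iff_lt_colLen.2 h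
    omega

/-- The numbers `μ_t - t - 1` and `j - μᵗ_j` exhaust the integers. -/
theorem exists_rowLen_or_colLen (μ : YoungDiagram) (x : ℤ) :
    (∃ t : ℕ, x = (μ.rowLen t : ℤ) - (t + 1)) ∨ ∃ j : ℕ, x = (j : ℤ) - μ.colLen j := by
  have hex : ∃ t : ℕ, (μ.rowLen t : ℤ) - (t + 1) ≤ x := by
    refine ⟨μ.rowLen 0 + x.natAbs, ?_⟩
    have := μ.rowLen_anti 0 (μ.rowLen 0 + x.natAbs) (Nat.zero_le _)
    omega
  classical
  -- Let `t` be the first row with `μ_t - t - 1 ≤ x`. If the inequality is strict, column `j = x +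
  -- t` ends exactly above row `t`: `(t, j)` lies outside `μ`, while `(t - 1, j)` lies inside when
  -- `t > 0`.
  set t := Nat.find hex with ht
  have h1 : (μ.rowLen t : ℤ) - (t + 1) ≤ x := Nat.find_spec hex
  by_cases h2 : x = (μ.rowLen t : ℤ) - (t + 1)
  · exact Or.inl ⟨t, h2⟩
  · right
    obtain ⟨j, hj⟩ : ∃ j : ℕ, (j : ℤ) = x + t := ⟨(x + t).toNat, by omega⟩
    refine ⟨j, ?_⟩
    have h3 : (t, j) ∉ μ := fun h => by
      have := YoungDiagram.mem_iff_lt_rowLen.1 h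
      omega
    have h4 := mt YoungDiagram.mem_iff_lt_colLen.2 h3
    rcases Nat.eq_zero_or_pos t with h0 | h0
    · omega
    · have h5 : ¬ (μ.rowLen (t - 1) : ℤ) - ((t - 1 : ℕ) + 1) ≤ x :=
        Nat.find_min hex (show t - 1 < Nat.find hex by omega)
      have h6 : (t - 1, j) ∈ μ := YoungDiagram.mem_iff_lt_rowLen.2 (by omega)
      have := YoungDiagram.mem_iff_lt_colLen.1 h6
      omega

/-- The numbers `μ_t - t - 1` and `j - μᵗ_j` together fill the integers without overlap. The
diagonal separates the signs: rows meeting it give the nonnegative elements, and columns meeting it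
give the negative gaps. -/
theorem mem_ofPartition (μ : YoungDiagram) (r : ℤ) :
    r ∈ (Admissible.ofPartition μ).1 ↔ (∃ t < diagLen μ, r = arm μ t) ∨
      (r < 0 ∧ ∀ t < diagLen μ, r ≠ -(leg μ t : ℤ) - 1) := by
  change (∃ t : ℕ, (μ.rowLen t : ℤ) - (t + 1) = r) ↔ _
  constructor
  · rintro ⟨t, rfl⟩
    by_cases ht : t < diagLen μ
    · exact Or.inl ⟨t, ht, (arm_eq ht).symm⟩
    · have h1 := mt (lt_diagLen μ).2 ht
      have h2 := mt YoungDiagram.mem_iff_lt_rowLen.2 h1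
      refine Or.inr ⟨by omega, fun s hs h => rowLen_sub_ne μ t s ?_⟩
      rw [h, leg_eq hs]
      ring
  · rintro (⟨t, ht, rfl⟩ | ⟨hr, h⟩)
    · exact ⟨t, (arm_eq ht).symm⟩
    · rcases exists_rowLen_or_colLen μ r with ⟨t, rfl⟩ | ⟨j, rfl⟩
      · exact ⟨t, rfl⟩
      · have hj : j < diagLen μ :=
          (lt_diagLen μ).2 (YoungDiagram.mem_iff_lt_colLen.2 (by omega))
        refine absurd ?_ (h j hj)
        rw [leg_eq hj]
        ring

/-- The admissible set with the Frobenius coordinates of the first `t` diagonal hooks of `μ`. -/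
def truncated (μ : YoungDiagram) (t : ℕ) : Admissible :=
  ⟨{r | (∃ s < t, r = arm μ s) ∨ (r < 0 ∧ ∀ s < t, r ≠ -(leg μ s : ℤ) - 1)}, by
    constructor
    · refine ((Set.finite_Iio t).image fun s => -(leg μ s : ℤ) - 1).subset ?_
      rintro r ⟨hr, hr'⟩
      by_contra h
      exact hr' (Or.inr ⟨hr, fun s hs e => h ⟨s, hs, e.symm⟩⟩)
    · refine ((Set.finite_Iio t).image fun s => (arm μ s : ℤ)).subset ?_
      rintro r ⟨⟨s, hs, rfl⟩ | ⟨hr, -⟩, hr'⟩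
      · exact ⟨s, hs, rfl⟩
      · exact absurd hr hr'⟩

theorem mem_truncated {t : ℕ} {r : ℤ} : r ∈ (truncated μ t).1 ↔
    (∃ s < t, r = arm μ s) ∨ (r < 0 ∧ ∀ s < t, r ≠ -(leg μ s : ℤ) - 1) := Iff.rfl

theorem truncated_zero : truncated μ 0 = .vacuum :=
  Admissible.ext_mem fun r => by rw [mem_truncated]; simp [Admissible.vacuum]

theorem truncated_diagLen : truncated μ (diagLen μ) = .ofPartition μ :=
  Admissible.ext_mem fun r => by rw [mem_truncated, mem_ofPartition]

theorem ncard_arms {t : ℕ} (ht : t < diagLen μ) :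
    ((fun s => (arm μ s : ℤ)) '' (Finset.range t : Set ℕ)).ncard = t := by
  rw [Set.InjOn.ncard_image, Set.ncard_coe_finset, Finset.card_range]
  intro a ha b hb hab
  simp only [Finset.coe_range, Set.mem_Iio, Nat.cast_inj] at ha hb hab
  exact arm_injective (by omega) (by omega) hab

theorem above_truncated_arm {t : ℕ} (ht : t < diagLen μ) :
    (truncated μ t).above (arm μ t) = t := by
  refine Eq.trans ?_ (ncard_arms ht)
  unfold Admissible.above
  congr 1
  ext r
  simp only [Set.mem_ofPred_eq, mem_truncated, Set.mem_image, Finset.coe_range, Set.mem_Iio]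
  constructor
  · rintro ⟨⟨s, hs, rfl⟩ | ⟨h, -⟩, h2⟩
    · exact ⟨s, hs, rfl⟩
    · omega
  · rintro ⟨s, hs, rfl⟩
    exact ⟨Or.inl ⟨s, hs, rfl⟩, by exact_mod_cast arm_lt_arm hs ht⟩

theorem above_truncated_leg {t : ℕ} (ht : t < diagLen μ) :
    (truncated μ t).above (-(leg μ t : ℤ) - 1) = t + leg μ t := by
  have h : {r ∈ (truncated μ t).1 | -(leg μ t : ℤ) - 1 < r} =
      (fun s => (arm μ s : ℤ)) '' (Finset.range t : Set ℕ) ∪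
        (Finset.Ioo (-(leg μ t : ℤ) - 1) 0 : Set ℤ) := by
    ext r
    simp only [Set.mem_ofPred_eq, mem_truncated, Set.mem_union, Set.mem_image, Finset.coe_range,
      Set.mem_Iio, Finset.coe_Ioo, Set.mem_Ioo]
    constructor
    · rintro ⟨⟨s, hs, rfl⟩ | ⟨h, -⟩, h2⟩
      · exact Or.inl ⟨s, hs, rfl⟩
      · exact Or.inr ⟨h2, h⟩
    · rintro (⟨s, hs, rfl⟩ | ⟨h1, h2⟩)
      · exact ⟨Or.inl ⟨s, hs, rfl⟩, by omega⟩
      · refine ⟨Or.inr ⟨h2, fun s hs e => ?_⟩, h1⟩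
        have := leg_lt_leg hs ht
        omega
  rw [Admissible.above, h, Set.ncard_union_eq, ncard_arms ht, Set.ncard_coe_finset, Int.card_Ioo]
  · omega
  · rw [Set.disjoint_left]
    rintro r ⟨s, -, rfl⟩ h2
    simp only [Finset.coe_Ioo, Set.mem_Ioo] at h2
    omega

/-- The hooks are created outermost first, so the `t` earlier arms all lie above the new one and are
passed by both operators; their signs cancel. The annihilator also passes the modes between `-leg -
1` and `0`. These are `leg` many and all still occupied, because the earlier legs are longer. -/
theorem psi_psiStar_truncated {K : Type*} [Field K] {t : ℕ} (ht : t < diagLen μ) :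
    psi K (arm μ t : ℤ) (psiStar K (-(leg μ t : ℤ) - 1) (ket K (truncated μ t))) =
      (-1 : K) ^ leg μ t • ket K (truncated μ (t + 1)) := by
  have h1 : -(leg μ t : ℤ) - 1 ∈ (truncated μ t).1 := by
    refine mem_truncated.2 (Or.inr ⟨by omega, fun s hs e => ?_⟩)
    have := leg_lt_leg hs ht
    omega
  have h2 : (arm μ t : ℤ) ∉ ((truncated μ t).remove (-(leg μ t : ℤ) - 1)).1 := by
    rw [Admissible.mem_remove, mem_truncated]
    rintro ⟨⟨s, hs, e⟩ | ⟨h, -⟩, -⟩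
    · have := arm_lt_arm hs ht
      omega
    · omega
  have h3 := Admissible.above_remove h1 (arm μ t : ℤ)
  rw [above_truncated_arm ht, if_neg (by omega), add_zero] at h3
  rw [psiStar_ket, if_pos h1, map_smul, psi_ket, if_neg h2, ← h3, above_truncated_leg ht, smul_smul,
    show ((truncated μ t).remove (-(leg μ t : ℤ) - 1)).add (arm μ t) = truncated μ (t + 1) from
      Admissible.ext_mem fun r => ?_]
  · congr 1
    rw [pow_add, mul_right_comm, ← pow_add, ← two_mul, pow_mul]
    simp
  · rw [Admissible.mem_add, Admissible.mem_remove, mem_truncated, mem_truncated]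
    constructor
    · rintro (rfl | ⟨⟨s, hs, rfl⟩ | ⟨hr, h⟩, h'⟩)
      · exact Or.inl ⟨t, by omega, rfl⟩
      · exact Or.inl ⟨s, by omega, rfl⟩
      · refine Or.inr ⟨hr, fun s hs => ?_⟩
        rcases Nat.lt_succ_iff_lt_or_eq.1 hs with hs | rfl
        · exact h s hs
        · exact h'
    · rintro (⟨s, hs, rfl⟩ | ⟨hr, h⟩)
      · rcases Nat.lt_succ_iff_lt_or_eq.1 hs with hs | rfl
        · exact Or.inr ⟨Or.inl ⟨s, hs, rfl⟩, by omega⟩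
        · exact Or.inl rfl
      · exact Or.inr ⟨Or.inr ⟨hr, fun s hs => h s (by omega)⟩, h t (by omega)⟩

end Frobenius

/-! ### Action of words on basis states -/

section States

variable {K : Type*} [Field K]

/-- The basis vectors of `ℱ ⊗ ℱ ⊗ ℱ`. -/
noncomputable def ket3 (K : Type*) [Field K] (f : Fin 3 → Admissible) : Fock3 K :=
  ket K (f 0) ⊗ₜ[K] (ket K (f 1) ⊗ₜ[K] ket K (f 2))

theorem vac3_eq_ket3 : vac3 K = ket3 K fun _ => .vacuum := rfl

theorem bra3_ket3 (μ : Fin 3 → YoungDiagram) (f : Fin 3 → Admissible) :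
    bra3 K μ (ket3 K f) = ∏ i, (ket K (f i)) (.ofPartition (μ i)) := by
  simp [bra3, ket3, Fin.prod_univ_three, mul_assoc]

theorem bra3_ket3_self (μ : Fin 3 → YoungDiagram) :
    bra3 K μ (ket3 K fun i => .ofPartition (μ i)) = 1 := by
  simp [bra3_ket3]

theorem eq_ofPartition_of_bra3_ne_zero {μ : Fin 3 → YoungDiagram} {f : Fin 3 → Admissible}
    (h : bra3 K μ (ket3 K f) ≠ 0) (i : Fin 3) : f i = .ofPartition (μ i) := by
  rw [bra3_ket3] at h
  by_contra hi
  exact h (Finset.prod_eq_zero (Finset.mem_univ i) (Finsupp.single_eq_of_ne' hi))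

/-- Used only to trace which basis state is reached, so the Koszul sign `u` is left unspecified. -/
theorem onFactor_ket3 {T : Module.End K (Fock K)} {f : Fin 3 → Admissible} {i : Fin 3} {c : K}
    {B : Admissible} (h : T (ket K (f i)) = c • ket K B) :
    ∃ u : K, onFactor K i T (ket3 K f) = (u * c) • ket3 K (Function.update f i B) := by
  fin_cases i
  · refine ⟨1, ?_⟩
    simp only [Fin.zero_eta] at h
    simp [onFactor, ket3, h, TensorProduct.smul_tmul']
  · refine ⟨(-1) ^ (f 0).charge, ?_⟩
    simp only [Fin.mk_one] at h
    simp only [onFactor, ket3, TensorProduct.map_tmul, parity_ket, h, LinearMap.id_apply,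
      TensorProduct.tmul_smul, ← TensorProduct.smul_tmul', smul_smul]
    congr 1
    ring
  · refine ⟨(-1) ^ (f 0).charge * (-1) ^ (f 1).charge, ?_⟩
    simp only [Fin.reduceFinMk] at h
    simp only [onFactor, ket3, TensorProduct.map_tmul, parity_ket, h,
      TensorProduct.tmul_smul, ← TensorProduct.smul_tmul', smul_smul]
    congr 1
    ring

/-- For two operators in the same factor the parities on the left square to the identity, so here
the coefficient is exact. -/
theorem onFactor_mul_onFactor_ket3 {S T : Module.End K (Fock K)} {f : Fin 3 → Admissible} {i : Fin 3}
    {c : K} {B : Admissible} (h : S (T (ket K (f i))) = c • ket K B) :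
    (onFactor K i S * onFactor K i T) (ket3 K f) = c • ket3 K (Function.update f i B) := by
  have hP : ∀ A, parity K (parity K (ket K A)) = ket K A := fun A => by
    rw [← Module.End.mul_apply, parity_mul_parity, Module.End.one_apply]
  fin_cases i
  · simp only [Fin.zero_eta] at h
    simp [onFactor, ket3, h, TensorProduct.smul_tmul']
  · simp only [Fin.mk_one] at h
    simp only [onFactor, ket3, Module.End.mul_apply, Fin.mk_one, TensorProduct.map_tmul, hP, h,
      LinearMap.id_apply, ← TensorProduct.smul_tmul', TensorProduct.tmul_smul]
    rfl
  · simp only [Fin.reduceFinMk] at h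
    simp only [onFactor, ket3, Module.End.mul_apply, Fin.reduceFinMk, TensorProduct.map_tmul, hP, h,
      TensorProduct.tmul_smul]
    rfl

/-- The creator of a pair. -/
def rowOf (x : PairIndex) : Fin 3 × ℕ := (x.1, x.2.2.1)

/-- The annihilator of a pair. -/
def colOf (x : PairIndex) : Fin 3 × ℕ := (x.2.1, x.2.2.2)

theorem psiPair_eq (x : PairIndex) :
    psiPair K x.1 x.2.1 x.2.2.1 x.2.2.2 = creator K (rowOf x) * annihilator K (colOf x) := rfl

/-- The occupied states of `f` are obtained from the vacuum by creating `P` and annihilating `Q`. -/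
def IsState (f : Fin 3 → Admissible) (P Q : List (Fin 3 × ℕ)) : Prop :=
  ∀ i, (∀ m : ℕ, (m : ℤ) ∈ (f i).1 ↔ (i, m) ∈ P) ∧ ∀ n : ℕ, -(n : ℤ) - 1 ∈ (f i).1 ↔ (i, n) ∉ Q

theorem annihilator_ket3 {f : Fin 3 → Admissible} {P Q : List (Fin 3 × ℕ)} (hf : IsState f P Q)
    (y : Fin 3 × ℕ) : ∃ (c : K) (g : Fin 3 → Admissible),
      annihilator K y (ket3 K f) = c • ket3 K g ∧ (c ≠ 0 → y ∉ Q ∧ IsState g P (y :: Q)) := by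
  obtain ⟨j, n⟩ := y
  by_cases h : -(n : ℤ) - 1 ∈ (f j).1
  · have h1 : psiStar K (-(n : ℤ) - 1) (ket K (f j)) =
        (-1 : K) ^ (f j).above (-(n : ℤ) - 1) • ket K ((f j).remove (-(n : ℤ) - 1)) := by
      rw [psiStar_ket, if_pos h]
    obtain ⟨u, hu⟩ := onFactor_ket3 h1
    refine ⟨_, _, hu, fun _ => ⟨((hf j).2 n).1 h, fun i => ?_⟩⟩
    by_cases hi : i = j
    · subst hi
      simp only [Function.update_self, Admissible.mem_remove, List.mem_cons, Prod.mk.injEq, true_and]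
      refine ⟨fun m => ?_, fun m => ?_⟩
      · rw [(hf i).1]
        exact ⟨fun h => h.1, fun h => ⟨h, by omega⟩⟩
      · rw [(hf i).2]
        constructor
        · rintro ⟨h1, h2⟩ (h3 | h3)
          · exact h2 (by omega)
          · exact h1 h3
        · exact fun h => ⟨fun h1 => h (Or.inr h1), fun h1 => h (Or.inl (by omega))⟩
    · simp only [Function.update_of_ne hi, List.mem_cons, Prod.mk.injEq, hi, false_and, false_or]
      exact hf i
  · refine ⟨0, f, ?_, fun h => absurd rfl h⟩
    have h1 : psiStar K (-(n : ℤ) - 1) (ket K (f j)) = (0 : K) • ket K (f j) := by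
      rw [psiStar_ket, if_neg h, zero_smul]
    obtain ⟨u, hu⟩ := onFactor_ket3 h1
    rw [annihilator, hu, mul_zero, zero_smul, zero_smul]

theorem creator_ket3 {f : Fin 3 → Admissible} {P Q : List (Fin 3 × ℕ)} (hf : IsState f P Q)
    (x : Fin 3 × ℕ) : ∃ (c : K) (g : Fin 3 → Admissible),
      creator K x (ket3 K f) = c • ket3 K g ∧ (c ≠ 0 → x ∉ P ∧ IsState g (x :: P) Q) := by
  obtain ⟨j, n⟩ := x
  by_cases h : (n : ℤ) ∈ (f j).1
  · refine ⟨0, f, ?_, fun h => absurd rfl h⟩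
    have h1 : psi K (n : ℤ) (ket K (f j)) = (0 : K) • ket K (f j) := by
      rw [psi_ket, if_pos h, zero_smul]
    obtain ⟨u, hu⟩ := onFactor_ket3 h1
    rw [creator, hu, mul_zero, zero_smul, zero_smul]
  · have h1 : psi K (n : ℤ) (ket K (f j)) =
        (-1 : K) ^ (f j).above n • ket K ((f j).add n) := by
      rw [psi_ket, if_neg h]
    obtain ⟨u, hu⟩ := onFactor_ket3 h1
    refine ⟨_, _, hu, fun _ => ⟨mt ((hf j).1 n).2 h, fun i => ?_⟩⟩
    by_cases hi : i = j
    · subst hi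
      simp only [Function.update_self, Admissible.mem_add, List.mem_cons, Prod.mk.injEq, true_and]
      refine ⟨fun m => ?_, fun m => ?_⟩
      · rw [(hf i).1, Nat.cast_inj]
      · rw [(hf i).2]
        exact ⟨fun h => h.resolve_left (by omega), Or.inr⟩
    · simp only [Function.update_of_ne hi, List.mem_cons, Prod.mk.injEq, hi, false_and, false_or]
      exact hf i

/-- A letter sends a basis state to a multiple of a basis state, and to zero if its creation mode is
already filled or its annihilation mode already emptied. Hence the modes of a surviving word do not
repeat and can be read off the final state. The scalar is determined later, by comparison with one
reference word. -/
theorem word_apply_vac3 (w : List PairIndex) : ∃ (c : K) (f : Fin 3 → Admissible),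
    (w.map fun x => psiPair K x.1 x.2.1 x.2.2.1 x.2.2.2).prod (vac3 K) = c • ket3 K f ∧
      (c ≠ 0 → (w.map rowOf).Nodup ∧ (w.map colOf).Nodup ∧ IsState f (w.map rowOf) (w.map colOf)) := by
  induction w with
  | nil =>
    refine ⟨1, fun _ => .vacuum, by simp [vac3_eq_ket3], fun _ => ⟨List.nodup_nil, List.nodup_nil, ?_⟩⟩
    intro i
    simp only [Admissible.vacuum, Set.mem_Iio, List.map_nil, List.not_mem_nil, not_false_eq_true,
      iff_true, iff_false]
    exact ⟨fun m => by omega, fun n => by omega⟩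
  | cons x w ih =>
    obtain ⟨c, f, h1, h2⟩ := ih
    rw [List.map_cons, List.prod_cons, Module.End.mul_apply, h1, psiPair_eq, Module.End.mul_apply,
      map_smul]
    by_cases hc : c = 0
    · exact ⟨0, f, by rw [hc, zero_smul, map_zero, zero_smul], fun h => absurd rfl h⟩
    · obtain ⟨h3, h4, h5⟩ := h2 hc
      obtain ⟨c', g, h6, h7⟩ := annihilator_ket3 (K := K) h5 (colOf x)
      rw [h6, map_smul, map_smul]
      by_cases hc' : c' = 0
      · exact ⟨0, f, by rw [hc', zero_smul, smul_zero, zero_smul], fun h => absurd rfl h⟩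
      · obtain ⟨h8, h9⟩ := h7 hc'
        obtain ⟨c'', g', h10, h11⟩ := creator_ket3 (K := K) h9 (rowOf x)
        refine ⟨c * (c' * c''), g', by rw [h10, smul_smul, smul_smul, mul_assoc], fun h => ?_⟩
        obtain ⟨h12, h13⟩ := h11 (right_ne_zero_of_mul (right_ne_zero_of_mul h))
        exact ⟨List.nodup_cons.2 ⟨h12, h3⟩, List.nodup_cons.2 ⟨h8, h4⟩, h13⟩

theorem of_bra3_word_ne_zero {μ : Fin 3 → YoungDiagram} {w : List PairIndex}
    (h : bra3 K μ ((w.map fun x => psiPair K x.1 x.2.1 x.2.2.1 x.2.2.2).prod (vac3 K)) ≠ 0) :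
    (w.map rowOf).Nodup ∧ (w.map colOf).Nodup ∧
      (∀ i m, (i, m) ∈ w.map rowOf ↔ ∃ t < diagLen (μ i), m = arm (μ i) t) ∧
      ∀ i n, (i, n) ∈ w.map colOf ↔ ∃ t < diagLen (μ i), n = leg (μ i) t := by
  obtain ⟨c, f, h1, h2⟩ := word_apply_vac3 (K := K) w
  rw [h1, map_smul, smul_eq_mul] at h
  obtain ⟨h3, h4, h5⟩ := h2 (left_ne_zero_of_mul h)
  have h6 := eq_ofPartition_of_bra3_ne_zero (right_ne_zero_of_mul h)
  refine ⟨h3, h4, fun i m => ?_, fun i n => ?_⟩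
  · rw [← (h5 i).1, h6, mem_ofPartition]
    simp only [Nat.cast_inj]
    exact ⟨fun h => h.resolve_right (by omega), Or.inl⟩
  · rw [← not_iff_not, ← (h5 i).2, h6, mem_ofPartition]
    constructor
    · rintro (⟨t, -, h⟩ | ⟨-, h⟩)
      · omega
      · rintro ⟨t, ht, rfl⟩
        exact h t ht rfl
    · intro h
      refine Or.inr ⟨by omega, fun t ht e => h ⟨t, ht, by omega⟩⟩

/-- The list is reversed because the rightmost operator acts first: the outermost hook is created
first, as `psi_psiStar_truncated` requires. -/
theorem prod_hooks_ket3 (μ : YoungDiagram) (i : Fin 3) (f : Fin 3 → Admissible)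
    (hf : f i = .vacuum) (t : ℕ) (ht : t ≤ diagLen μ) :
    (((List.range t).reverse.map fun s => psiPair K i i (arm μ s) (leg μ s)).prod) (ket3 K f) =
      (-1 : K) ^ (∑ s ∈ Finset.range t, leg μ s) • ket3 K (Function.update f i (truncated μ t)) := by
  induction t with
  | zero => simp [truncated_zero, ← hf]
  | succ t ih =>
    rw [List.range_succ, List.reverse_append, List.reverse_singleton, List.singleton_append,
      List.map_cons, List.prod_cons, Module.End.mul_apply, ih (by omega), map_smul, psiPair,
      onFactor_mul_onFactor_ket3 (c := (-1 : K) ^ leg μ t) (B := truncated μ (t + 1)),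
      Function.update_idem, smul_smul, ← pow_add, Finset.sum_range_succ]
    rw [Function.update_self]
    exact psi_psiStar_truncated (by omega)

end States

/-! ### Wick's theorem: the sum over words as a determinant -/

section WordSum

variable (μ : Fin 3 → YoungDiagram)

/-- The diagonal hooks of three partitions. -/
abbrev Hooks : Type := Σ i : Fin 3, Fin (diagLen (μ i))

variable {μ}

/-- The arm length of a diagonal hook. -/
def Hooks.arm (x : Hooks μ) : ℕ := FramedVertex.arm (μ x.1) x.2

/-- The leg length of a diagonal hook. -/
def Hooks.leg (x : Hooks μ) : ℕ := FramedVertex.leg (μ x.1) x.2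

theorem Hooks.arm_injective : Function.Injective fun x : Hooks μ => (x.1, x.arm) := by
  rintro ⟨i, s⟩ ⟨j, t⟩ h
  obtain ⟨rfl, h2⟩ := Prod.mk.inj h
  rw [Fin.ext (FramedVertex.arm_injective s.2 t.2 h2)]

theorem Hooks.leg_injective : Function.Injective fun x : Hooks μ => (x.1, x.leg) := by
  rintro ⟨i, s⟩ ⟨j, t⟩ h
  obtain ⟨rfl, h2⟩ := Prod.mk.inj h
  rw [Fin.ext (FramedVertex.leg_injective s.2 t.2 h2)]

variable (μ)

/-- The diagonal hooks, the innermost ones first. -/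
def hookList : List (Hooks μ) :=
  (List.finRange 3).flatMap fun i =>
    (List.finRange (diagLen (μ i))).reverse.map fun t => (⟨i, t⟩ : Hooks μ)

theorem nodup_hookList : (hookList μ).Nodup := by
  rw [hookList, List.nodup_flatMap]
  refine ⟨fun i _ => (List.nodup_reverse.2 (List.nodup_finRange _)).map fun s t h => by simpa using h, ?_⟩
  refine (List.nodup_finRange 3).imp fun {i j} hij => ?_
  rintro x hx hy
  simp only [List.mem_map] at hx hy
  obtain ⟨s, -, rfl⟩ := hx
  obtain ⟨t, -, h⟩ := hy
  exact hij (congrArg Sigma.fst h).symm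

theorem mem_hookList (x : Hooks μ) : x ∈ hookList μ := by
  rw [hookList, List.mem_flatMap]
  exact ⟨x.1, List.mem_finRange _, List.mem_map.2 ⟨x.2, by simp, rfl⟩⟩

/-- The numbering of the diagonal hooks by `hookList`. -/
def hookEquiv : Fin (hookList μ).length ≃ Hooks μ :=
  (nodup_hookList μ).getEquivOfForallMemList _ (mem_hookList μ)

variable {K : Type*} [Field K]

theorem prod_hookList_vac3 :
    (((hookList μ).map fun x => psiPair K x.1 x.1 x.arm x.leg).prod) (vac3 K) =
      (-1 : K) ^ (∑ x : Hooks μ, x.leg) • ket3 K fun i => .ofPartition (μ i) := by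
  have h : ∀ i : Fin 3, ((List.finRange (diagLen (μ i))).reverse.map fun t => (⟨i, t⟩ : Hooks μ)).map
      (fun x : Hooks μ => psiPair K x.1 x.1 x.arm x.leg) = (List.range (diagLen (μ i))).reverse.map fun s =>
        psiPair K i i (arm (μ i) s) (leg (μ i) s) := by
    intro i
    rw [List.map_map, ← List.map_coe_finRange_eq_range, ← List.map_reverse, List.map_map]
    rfl
  have h3 : List.finRange 3 = [0, 1, 2] := rfl
  rw [hookList, h3, List.map_flatMap]
  simp only [List.flatMap_cons, List.flatMap_nil, List.append_nil, List.prod_append, h,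
    Module.End.mul_apply, vac3_eq_ket3]
  rw [prod_hooks_ket3 (μ 2) 2 _ rfl _ le_rfl, map_smul, prod_hooks_ket3 (μ 1) 1 _ rfl _ le_rfl,
    map_smul, map_smul, prod_hooks_ket3 (μ 0) 0 _ rfl _ le_rfl, smul_smul, smul_smul, ← pow_add,
    ← pow_add]
  congr 2
  · rw [Fintype.sum_sigma, Fin.sum_univ_three]
    simp only [Hooks.leg, Finset.sum_range]
    ring
  · funext i
    fin_cases i <;> simp [truncated_diagLen, Function.update]

/-- The word pairing the arms of the hooks, permuted by `α`, with the legs, permuted by `β`. -/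
def permWord (z : Equiv.Perm (Fin (hookList μ).length) × Equiv.Perm (Fin (hookList μ).length)) :
    List PairIndex :=
  List.ofFn fun t => ((hookEquiv μ (z.1 t)).1, (hookEquiv μ (z.2 t)).1,
    (hookEquiv μ (z.1 t)).arm, (hookEquiv μ (z.2 t)).leg)

theorem permWord_injective : Function.Injective (permWord μ) := by
  rintro ⟨α, β⟩ ⟨α', β'⟩ h
  have h1 := List.ofFn_injective h
  have h2 : α = α' := Equiv.ext fun t => (hookEquiv μ).injective (Hooks.arm_injective (by
    have := congrFun h1 t
    simp only [Prod.mk.injEq] at this ⊢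
    tauto))
  have h3 : β = β' := Equiv.ext fun t => (hookEquiv μ).injective (Hooks.leg_injective (by
    have := congrFun h1 t
    simp only [Prod.mk.injEq] at this ⊢
    tauto))
  rw [h2, h3]

theorem exists_permWord_eq {w : List PairIndex}
    (h : bra3 K μ ((w.map fun x => psiPair K x.1 x.2.1 x.2.2.1 x.2.2.2).prod (vac3 K)) ≠ 0) :
    ∃ z, permWord μ z = w := by
  obtain ⟨h1, h2, h3, h4⟩ := of_bra3_word_ne_zero h
  have hlen : w.length = (hookList μ).length := by
    have e1 : (w.map rowOf).toFinset = Finset.univ.image fun x : Hooks μ => (x.1, x.arm) := by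
      ext ⟨i, m⟩
      rw [List.mem_toFinset, h3, Finset.mem_image]
      constructor
      · rintro ⟨t, ht, rfl⟩
        exact ⟨⟨i, ⟨t, ht⟩⟩, Finset.mem_univ _, rfl⟩
      · rintro ⟨⟨j, t⟩, -, e⟩
        obtain ⟨rfl, rfl⟩ := Prod.mk.inj e
        exact ⟨t, t.2, rfl⟩
    have e2 := congrArg Finset.card e1
    rw [List.toFinset_card_of_nodup h1, List.length_map,
      Finset.card_image_of_injective _ Hooks.arm_injective, Finset.card_univ,
      ← Fintype.card_congr (hookEquiv μ), Fintype.card_fin] at e2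
    exact e2
  obtain ⟨g, rfl⟩ : ∃ g : Fin (hookList μ).length → PairIndex, List.ofFn g = w :=
    ⟨fun t => w.get (t.cast hlen.symm), List.ext_getElem (by simp [hlen]) (by simp)⟩
  rw [List.map_ofFn, List.nodup_ofFn] at h1 h2
  have hp : ∀ t, ∃ x : Hooks μ, (x.1, x.arm) = rowOf (g t) := fun t => by
    obtain ⟨s, hs, e⟩ := (h3 (rowOf (g t)).1 (rowOf (g t)).2).1 (List.mem_map_of_mem (by simp))
    exact ⟨⟨(rowOf (g t)).1, ⟨s, hs⟩⟩, Prod.ext rfl e.symm⟩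
  have hq : ∀ t, ∃ x : Hooks μ, (x.1, x.leg) = colOf (g t) := fun t => by
    obtain ⟨s, hs, e⟩ := (h4 (colOf (g t)).1 (colOf (g t)).2).1 (List.mem_map_of_mem (by simp))
    exact ⟨⟨(colOf (g t)).1, ⟨s, hs⟩⟩, Prod.ext rfl e.symm⟩
  choose p hp using hp
  choose q hq using hq
  -- Letters with distinct creators come from distinct hooks; as there are as many letters as hooks,
  -- this injection of a finite set into itself is a permutation.
  have hp1 : Function.Injective fun t => (hookEquiv μ).symm (p t) := fun s t hst => by
    have := (hookEquiv μ).symm.injective hst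
    exact h1 (by simp only [Function.comp, ← hp, this])
  have hq1 : Function.Injective fun t => (hookEquiv μ).symm (q t) := fun s t hst => by
    have := (hookEquiv μ).symm.injective hst
    exact h2 (by simp only [Function.comp, ← hq, this])
  refine ⟨(Equiv.ofBijective _ (Finite.injective_iff_bijective.1 hp1),
    Equiv.ofBijective _ (Finite.injective_iff_bijective.1 hq1)), ?_⟩
  rw [permWord]
  congr 1
  funext t
  simp only [Equiv.ofBijective_apply, Equiv.apply_symm_apply]
  have e1 := hp t
  have e2 := hq t
  simp only [rowOf, colOf, Prod.mk.injEq] at e1 e2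
  rw [e1.1, e1.2, e2.1, e2.2]

/-- Every such word is a rearrangement of the word pairing each hook's arm with its own leg in the
order of `hookList`, so only that word has to be evaluated on the vacuum. -/
theorem bra3_permWord [CharZero K] (α β : Equiv.Perm (Fin (hookList μ).length)) :
    bra3 K μ (((permWord μ (α, β)).map fun x => psiPair K x.1 x.2.1 x.2.2.1 x.2.2.2).prod (vac3 K)) =
      ((Equiv.Perm.sign α : ℤ) * (Equiv.Perm.sign β : ℤ) : K) * (-1) ^ (∑ x : Hooks μ, x.leg) := by
  have h := prod_ofFn_mul_comp_perm (K := K) (X := creator K) (Y := annihilator K)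
    creator_mul_creator annihilator_mul_annihilator annihilator_mul_creator
    (fun t => ((hookEquiv μ t).1, (hookEquiv μ t).arm))
    (fun t => ((hookEquiv μ t).1, (hookEquiv μ t).leg)) α β
  have h' : (List.ofFn fun t => creator K ((hookEquiv μ t).1, (hookEquiv μ t).arm) *
      annihilator K ((hookEquiv μ t).1, (hookEquiv μ t).leg)) =
      (hookList μ).map fun x => psiPair K x.1 x.1 x.arm x.leg := by
    conv_rhs => rw [← List.ofFn_get (hookList μ), List.map_ofFn]
    rfl
  rw [h'] at h
  rw [permWord, List.map_ofFn]
  change bra3 K μ ((List.ofFn fun t => creator K ((hookEquiv μ (α t)).1, (hookEquiv μ (α t)).arm) *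
      annihilator K ((hookEquiv μ (β t)).1, (hookEquiv μ (β t)).leg)).prod (vac3 K)) = _
  rw [h, LinearMap.smul_apply, prod_hookList_vac3, map_smul, map_smul, bra3_ket3_self, smul_eq_mul,
    smul_eq_mul, mul_one]

/-- For fixed `β` the sum over `α` is the determinant of `B` with columns permuted by `β`, whose
sign cancels that of `β`. Each of the `k!` choices of `β` thus gives `det B`. -/
theorem sum_perm_perm_eq_factorial_mul_det {R : Type*} [CommRing R] {k : ℕ}
    (B : Matrix (Fin k) (Fin k) R) :
    ∑ z : Equiv.Perm (Fin k) × Equiv.Perm (Fin k),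
      ((Equiv.Perm.sign z.1 : ℤ) * (Equiv.Perm.sign z.2 : ℤ) : R) * ∏ t, B (z.1 t) (z.2 t) =
      (k.factorial : R) * B.det := by
  rw [Fintype.sum_prod_type_right]
  have h : ∀ β : Equiv.Perm (Fin k), ∑ α : Equiv.Perm (Fin k),
      ((Equiv.Perm.sign α : ℤ) * (Equiv.Perm.sign β : ℤ) : R) * ∏ t, B (α t) (β t) = B.det := by
    intro β
    have h1 := Matrix.det_permute' β B
    rw [Matrix.det_apply'] at h1
    simp only [Matrix.submatrix_apply, id] at h1
    have h2 : ((Equiv.Perm.sign β : ℤ) : R) * ((Equiv.Perm.sign β : ℤ) : R) = 1 := by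
      rw [← Int.cast_mul, ← Units.val_mul, Int.units_mul_self]
      simp
    calc _ = ((Equiv.Perm.sign β : ℤ) : R) * ∑ α : Equiv.Perm (Fin k),
          ((Equiv.Perm.sign α : ℤ) : R) * ∏ t, B (α t) (β t) := by
          rw [Finset.mul_sum]
          exact Finset.sum_congr rfl fun α _ => by ring
      _ = _ := by rw [h1, ← mul_assoc, h2, one_mul]
  simp only [h, Finset.sum_const, Finset.card_univ, Fintype.card_perm, Fintype.card_fin, nsmul_eq_mul]

variable (v : K) (a : Fin 3 → ℤ)

/-- The matrix of the coefficients `A^{ij}` at the Frobenius coordinates of three partitions. -/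
noncomputable def hookMatrix : Matrix (Hooks μ) (Hooks μ) K :=
  .of fun x y => framedCoeff v a x.1 y.1 x.arm y.leg

theorem support_wordTerm_subset :
    Function.support (wordTerm v a μ) ⊆ Set.range (permWord μ) :=
  fun _ hw => exists_permWord_eq μ (right_ne_zero_of_mul hw)

theorem wordTerm_permWord [CharZero K]
    (z : Equiv.Perm (Fin (hookList μ).length) × Equiv.Perm (Fin (hookList μ).length)) :
    wordTerm v a μ (permWord μ z) = (((hookList μ).length.factorial : K)⁻¹ *
      (-1) ^ (∑ x : Hooks μ, x.leg)) *
        (((Equiv.Perm.sign z.1 : ℤ) * (Equiv.Perm.sign z.2 : ℤ) : K) *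
          ∏ t, ((hookMatrix μ v a).submatrix (hookEquiv μ) (hookEquiv μ)) (z.1 t) (z.2 t)) := by
  obtain ⟨α, β⟩ := z
  rw [wordTerm, bra3_permWord, permWord, List.length_ofFn, List.map_ofFn, List.prod_ofFn]
  simp only [Function.comp, Matrix.submatrix_apply, hookMatrix, Matrix.of_apply]
  ring

theorem fermionicVertex_eq_det [CharZero K] :
    fermionicVertex v a μ = (-1) ^ (∑ x : Hooks μ, x.leg) * (hookMatrix μ v a).det := by
  have h1 : fermionicVertex v a μ = ∑ᶠ w ∈ Set.range (permWord μ), wordTerm v a μ w := by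
    rw [fermionicVertex, ← finsum_mem_univ]
    exact finsum_mem_inter_support_eq' _ _ _ fun w hw =>
      ⟨fun _ => support_wordTerm_subset μ v a hw, fun _ => Set.mem_univ _⟩
  rw [h1, finsum_mem_range (permWord_injective μ), finsum_eq_sum_of_fintype]
  simp only [wordTerm_permWord]
  rw [← Finset.mul_sum, sum_perm_perm_eq_factorial_mul_det, Matrix.det_submatrix_equiv_self]
  have : ((hookList μ).length.factorial : K) ≠ 0 := by
    exact_mod_cast Nat.factorial_ne_zero _
  field_simp

theorem finite_support_wordTerm : (Function.support (wordTerm v a μ)).Finite :=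
  (Set.finite_range (permWord μ)).subset (support_wordTerm_subset μ v a)

end WordSum

/-! ### Cauchy–Binet for bordered minors, and determinants of block matrices -/

section Determinants

open Matrix

variable {R : Type*} [CommRing R]

theorem exists_perm_of_det_ne_zero {X : Type*} [Fintype X] [DecidableEq X] {M : Matrix X X R}
    (h : M.det ≠ 0) : ∃ σ : Equiv.Perm X, ∀ x, M (σ x) x ≠ 0 := by
  rw [det_apply'] at h
  obtain ⟨σ, -, hσ⟩ := Finset.exists_ne_zero_of_sum_ne_zero h
  refine ⟨σ, fun x hx => hσ ?_⟩
  have : ∏ i, M (σ i) i = 0 := Finset.prod_eq_zero (Finset.mem_univ x) hx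
  rw [this, mul_zero]

/-- The rows of `p` outside `T` are unit vectors. Expanding along them deletes these indices and
leaves the principal minor on `n ⊕ T`. -/
theorem det_bordered_piecewise {n p : Type*} [Fintype n] [DecidableEq n] [Fintype p]
    [DecidableEq p] (S : Matrix n n R) (U : Matrix n p R) (V : Matrix p n R) (T : Finset p) :
    (of ((T.map Function.Embedding.inr).piecewise (fromBlocks S U V 0).row
      (fromBlocks S U 0 1).row)).det =
      (fromBlocks S (U.submatrix id ((↑) : T → p)) (V.submatrix ((↑) : T → p) id) 0).det := by
  let s : Finset (n ⊕ p) := Finset.univ.disjSum T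
  have h1 : of ((T.map Function.Embedding.inr).piecewise (fromBlocks S U V 0).row
      (fromBlocks S U 0 1).row) =
      of (s.piecewise (fromBlocks S U V 0).row (1 : Matrix (n ⊕ p) (n ⊕ p) R).row) := by
    congr 1
    funext x
    rcases x with x | x
    · rw [Finset.piecewise_eq_of_notMem _ _ _ (by simp), Finset.piecewise_eq_of_mem _ _ _ (by simp [s])]
      funext y
      rcases y with y | y <;> simp [Matrix.row]
    · by_cases hx : x ∈ T
      · rw [Finset.piecewise_eq_of_mem _ _ _ (by simpa using hx),
          Finset.piecewise_eq_of_mem _ _ _ (by simpa [s] using hx)]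
      · rw [Finset.piecewise_eq_of_notMem _ _ _ (by simpa using hx),
          Finset.piecewise_eq_of_notMem _ _ _ (by simpa [s] using hx)]
        funext y
        rcases y with y | y <;> simp [Matrix.row, Matrix.one_apply]
  let e : n ⊕ T ≃ s := Equiv.ofBijective
    (Sum.elim (fun x => ⟨Sum.inl x, by simp [s]⟩) (fun t => ⟨Sum.inr t.1, by simp [s]⟩)) (by
      constructor
      · rintro (x | x) (y | y) h
        · exact congrArg _ (Sum.inl.inj (congrArg Subtype.val h))
        · cases congrArg Subtype.val h
        · cases congrArg Subtype.val h
        · exact congrArg _ (Subtype.ext (Sum.inr.inj (congrArg Subtype.val h)))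
      · rintro ⟨x | x, hx⟩
        · exact ⟨Sum.inl x, rfl⟩
        · exact ⟨Sum.inr ⟨x, by simpa [s] using hx⟩, rfl⟩)
  rw [h1, det_piecewise_one_eq_submatrix_det, ← det_submatrix_equiv_self e]
  congr 1
  ext (x | x) (y | y) <;> rfl

/-- The Cauchy–Binet expansion of `det (S + U diag(w) V)` into bordered minors. -/
theorem det_add_mul_diagonal_mul {n p : Type*} [Fintype n] [DecidableEq n] [Fintype p]
    [DecidableEq p] (S : Matrix n n R) (U : Matrix n p R) (w : p → R) (V : Matrix p n R) :
    (S + U * diagonal w * V).det = ∑ T : Finset p, (∏ t ∈ T, -w t) *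
      (fromBlocks S (U.submatrix id ((↑) : T → p)) (V.submatrix ((↑) : T → p) id) 0).det := by
  -- The sum is a Schur complement. Each lower row `(V, 1)` of the enlarged matrix is `(V, 0) + (0,
  -- 1)`, and multilinearity in these rows gives one term for each set `T` of rows where `(V, 0)` is
  -- taken.
  have h1 : (S + U * diagonal w * V).det = (fromBlocks S (-(U * diagonal w)) V 1).det := by
    rw [det_fromBlocks_one₂₂, Matrix.neg_mul, sub_neg_eq_add]
  have h2 : (fromBlocks S (-(U * diagonal w)) V 1 : Matrix (n ⊕ p) (n ⊕ p) R) =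
      of ((Finset.univ.map Function.Embedding.inr : Finset (n ⊕ p)).piecewise
        ((fromBlocks S (-(U * diagonal w)) V 0).row + (fromBlocks S (-(U * diagonal w)) 0 1).row)
        (fromBlocks S (-(U * diagonal w)) 0 1).row) := by
    ext x y
    rw [of_apply]
    rcases x with x | x
    · rw [Finset.piecewise_eq_of_notMem _ _ _ (by simp)]
      rcases y with y | y <;> simp [Matrix.row]
    · rw [Finset.piecewise_eq_of_mem _ _ _ (by simp)]
      rcases y with y | y
      · exact (add_zero (V x y)).symm
      · exact (zero_add ((1 : Matrix p p R) x y)).symm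
  rw [h1, h2]
  refine ((detRowAlternating (R := R) (n := n ⊕ p)).toMultilinearMap.map_piecewise_add _ _ _).trans ?_
  symm
  refine Finset.sum_bij (fun T _ => T.map Function.Embedding.inr) ?_ ?_ ?_ ?_
  · intro T _
    rw [Finset.mem_powerset]
    exact Finset.map_subset_map.2 (Finset.subset_univ T)
  · intro T _ T' _ h
    exact Finset.map_injective _ h
  · intro s hs
    rw [Finset.mem_powerset] at hs
    obtain ⟨T, -, rfl⟩ := Finset.subset_map_iff.1 hs
    exact ⟨T, Finset.mem_univ _, rfl⟩
  · intro T _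
    refine Eq.trans ?_ (det_bordered_piecewise S (-(U * diagonal w)) V T).symm
    -- The factors `-w t` are pulled out of the bordering columns.
    have h3 := det_mul_row (Sum.elim (fun _ => 1) fun t : T => -w t)
      (fromBlocks S (U.submatrix id ((↑) : T → p)) (V.submatrix ((↑) : T → p) id) 0)
    rw [Fintype.prod_sum_type] at h3
    simp only [Sum.elim_inl, Sum.elim_inr, Finset.prod_const_one, one_mul] at h3
    rw [← Finset.prod_coe_sort T (fun t => -w t), ← h3]
    congr 1
    ext (x | x) (y | y) <;> simp [mul_comm]

/-- The order enters only through `key`, so inversions can be counted in any convenient injective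
numbering of the index set. -/
theorem sign_eq_prod_inversions {α γ : Type*} [Fintype α] [DecidableEq α] [LinearOrder γ]
    {key : α → γ} (hkey : Function.Injective key) (σ : Equiv.Perm α) :
    (Equiv.Perm.sign σ : ℤ) =
      ∏ x, ∏ y, if key x < key y ∧ key (σ y) < key (σ x) then (-1 : ℤ) else 1 := by
  let _ : LinearOrder α := LinearOrder.lift' key hkey
  have hlt : ∀ x y, key x < key y ↔ x < y := fun _ _ => Iff.rfl
  let o := Fintype.orderIsoFinOfCardEq α rfl
  have h1 := Equiv.Perm.sign_symm_trans_trans σ o.symm.toEquiv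
  rw [← h1, Equiv.Perm.sign_eq_prod_prod_Ioi, Units.coe_prod, ← o.toEquiv.prod_comp]
  refine Finset.prod_congr rfl fun i _ => ?_
  rw [← o.toEquiv.prod_comp, Units.coe_prod, ← Finset.prod_subset (Finset.subset_univ (Finset.Ioi i))]
  · refine Finset.prod_congr rfl fun j hj => ?_
    have hij : o i < o j := o.lt_iff_lt.2 (Finset.mem_Ioi.1 hj)
    simp only [hlt, hij, true_and, RelIso.coe_fn_toEquiv]
    have hσ : ((o.symm.toEquiv.symm.trans σ).trans o.symm.toEquiv) i <
        ((o.symm.toEquiv.symm.trans σ).trans o.symm.toEquiv) j ↔ σ (o i) < σ (o j) :=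
      o.symm.lt_iff_lt
    rw [if_congr hσ rfl rfl]
    rcases lt_trichotomy (σ (o i)) (σ (o j)) with h | h | h
    · simp [h, h.not_gt]
    · exact absurd (σ.injective h) hij.ne
    · simp [h, h.not_gt]
  · intro j _ hj
    rw [if_neg]
    rintro ⟨h, -⟩
    exact hj (Finset.mem_Ioi.2 (o.lt_iff_lt.1 h))

/-- Reading rows through `f` and columns through `g` makes the matrix block diagonal. The sign
compares these two numberings of the same index set. -/
theorem det_eq_sign_mul_prod_det {ι X : Type*} [Fintype ι] [LinearOrder ι] [Fintype X]
    [DecidableEq X] {n : ι → ℕ} (f g : (Σ i, Fin (n i)) ≃ X) (M : Matrix X X R)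
    (h : ∀ i j p q, i ≠ j → M (f ⟨i, p⟩) (g ⟨j, q⟩) = 0) :
    M.det = (Equiv.Perm.sign (f.trans g.symm) : ℤ) *
      ∏ i, (of fun p q : Fin (n i) => M (f ⟨i, p⟩) (g ⟨i, q⟩)).det := by
  have h1 : (M.submatrix f g).det = ∏ i, (of fun p q : Fin (n i) => M (f ⟨i, p⟩) (g ⟨i, q⟩)).det := by
    have ht : BlockTriangular (M.submatrix f g) Sigma.fst := by
      rintro ⟨i, p⟩ ⟨j, q⟩ hij
      exact h _ _ _ _ (ne_of_gt hij)
    rw [ht.det_fintype]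
    refine Finset.prod_congr rfl fun i _ => ?_
    rw [← det_submatrix_equiv_self (Equiv.sigmaSubtype (β := fun i => Fin (n i)) i).symm]
    rfl
  have h2 := det_reindex f.symm g.symm M
  rw [reindex_apply, Equiv.symm_symm, Equiv.symm_symm, h1] at h2
  have h3 : Equiv.Perm.sign (g.symm.trans f) = Equiv.Perm.sign (f.trans g.symm) := by
    have := Equiv.Perm.sign_symm_trans_trans (f.trans g.symm) f
    rw [← this]
    congr 1
    ext x
    simp
  rw [h2, h3, ← mul_assoc, ← Int.cast_mul, ← Units.val_mul, Int.units_mul_self]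
  simp

end Determinants

/-! ### Sorting a bordered matrix into three blocks, and the sign of the sorting -/

section Blocks

variable (k : Fin 3 → ℕ) (r : Fin 3 → Fin 3 → ℕ)

/-- Index set of a bordered matrix: `k i` ordinary indices for each `i`,
and `r i j` bordering indices for each pair `(i, j)`. -/
abbrev BorderedIndex : Type := (Σ i, Fin (k i)) ⊕ Σ z : Fin 3 × Fin 3, Fin (r z.1 z.2)

/-- The rows of the `i`-th block. -/
def rowMap : (Σ i, Fin (k i) ⊕ (Fin (r (i + 1) i) ⊕ Fin (r (i + 2) i))) → BorderedIndex k r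
  | ⟨i, .inl p⟩ => .inl ⟨i, p⟩
  | ⟨i, .inr (.inl x)⟩ => .inr ⟨(i + 1, i), x⟩
  | ⟨i, .inr (.inr x)⟩ => .inr ⟨(i + 2, i), x⟩

/-- The columns of the `i`-th block. -/
def colMap : (Σ i, Fin (k i) ⊕ (Fin (r i (i + 2)) ⊕ Fin (r i (i + 1)))) → BorderedIndex k r
  | ⟨i, .inl p⟩ => .inl ⟨i, p⟩
  | ⟨i, .inr (.inl x)⟩ => .inr ⟨(i, i + 2), x⟩
  | ⟨i, .inr (.inr x)⟩ => .inr ⟨(i, i + 1), x⟩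

variable {k r}

theorem rowMap_bijective (hr : ∀ i, r i i = 0) : Function.Bijective (rowMap k r) := by
  constructor
  · rintro ⟨i, p | p | p⟩ ⟨j, q | q | q⟩ h <;>
      simp only [rowMap, Sum.inl.injEq, Sum.inr.injEq, reduceCtorEq, Sigma.mk.injEq, Prod.mk.injEq] at h
    · obtain ⟨rfl, h⟩ := h
      rw [eq_of_heq h]
    · obtain ⟨⟨-, rfl⟩, h⟩ := h
      rw [eq_of_heq h]
    · obtain ⟨⟨h1, rfl⟩, h⟩ := h
      exact absurd h1 (add_one_ne_add_two _)
    · obtain ⟨⟨h1, rfl⟩, h⟩ := h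
      exact absurd h1 (add_one_ne_add_two _).symm
    · obtain ⟨⟨-, rfl⟩, h⟩ := h
      rw [eq_of_heq h]
  · rintro (⟨i, p⟩ | ⟨⟨i, j⟩, x⟩)
    · exact ⟨⟨i, .inl p⟩, rfl⟩
    · rcases eq_or_eq_add_one_or_eq_add_two j i with rfl | rfl | rfl
      · exact absurd x.2 (by simp [hr])
      · exact ⟨⟨j, .inr (.inl x)⟩, rfl⟩
      · exact ⟨⟨j, .inr (.inr x)⟩, rfl⟩

theorem colMap_bijective (hr : ∀ i, r i i = 0) : Function.Bijective (colMap k r) := by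
  constructor
  · rintro ⟨i, p | p | p⟩ ⟨j, q | q | q⟩ h <;>
      simp only [colMap, Sum.inl.injEq, Sum.inr.injEq, reduceCtorEq, Sigma.mk.injEq, Prod.mk.injEq] at h
    · obtain ⟨rfl, h⟩ := h
      rw [eq_of_heq h]
    · obtain ⟨⟨rfl, -⟩, h⟩ := h
      rw [eq_of_heq h]
    · obtain ⟨⟨rfl, h1⟩, h⟩ := h
      exact absurd h1 (add_one_ne_add_two _).symm
    · obtain ⟨⟨rfl, h1⟩, h⟩ := h
      exact absurd h1 (add_one_ne_add_two _)
    · obtain ⟨⟨rfl, -⟩, h⟩ := h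
      rw [eq_of_heq h]
  · rintro (⟨i, p⟩ | ⟨⟨i, j⟩, x⟩)
    · exact ⟨⟨i, .inl p⟩, rfl⟩
    · rcases eq_or_eq_add_one_or_eq_add_two i j with rfl | rfl | rfl
      · exact absurd x.2 (by simp [hr])
      · exact ⟨⟨i, .inr (.inr x)⟩, rfl⟩
      · exact ⟨⟨i, .inr (.inl x)⟩, rfl⟩

/-- The rows of a bordered matrix, sorted into blocks. -/
noncomputable def rowEquiv (hr : ∀ i, r i i = 0) :
    (Σ i, Fin (k i + (r (i + 1) i + r (i + 2) i))) ≃ BorderedIndex k r :=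
  (Equiv.sigmaCongrRight fun _ => blockEquiv _ _ _).trans (Equiv.ofBijective _ (rowMap_bijective hr))

/-- The columns of a bordered matrix, sorted into blocks. -/
noncomputable def colEquiv (hr : ∀ i, r i i = 0)
    (hb : ∀ i, r i (i + 2) + r i (i + 1) = r (i + 1) i + r (i + 2) i) :
    (Σ i, Fin (k i + (r (i + 1) i + r (i + 2) i))) ≃ BorderedIndex k r :=
  (Equiv.sigmaCongrRight fun i => (finCongr (congrArg (k i + ·) (hb i)).symm).trans
    (blockEquiv _ _ _)).trans (Equiv.ofBijective _ (colMap_bijective hr))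

theorem rowEquiv_apply (hr : ∀ i, r i i = 0) (i p) :
    rowEquiv (k := k) hr ⟨i, p⟩ = rowMap k r ⟨i, blockEquiv _ _ _ p⟩ := rfl

theorem colEquiv_apply (hr : ∀ i, r i i = 0)
    (hb : ∀ i, r i (i + 2) + r i (i + 1) = r (i + 1) i + r (i + 2) i) (i p) :
    colEquiv (k := k) hr hb ⟨i, p⟩ = colMap k r
      ⟨i, blockEquiv _ _ _ (Fin.cast (congrArg (k i + ·) (hb i)).symm p)⟩ := rfl

/-- The label of an index: `i` or `(i, j)`. -/
def label : BorderedIndex k r → Fin 3 ⊕ (Fin 3 × Fin 3)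
  | .inl x => .inl x.1
  | .inr x => .inr x.1

/-- The position of an index among those with the same label. -/
def offset : BorderedIndex k r → ℕ
  | .inl x => x.2
  | .inr x => x.2

/-- The order in which the labels occur among the sorted rows. -/
def rowPos : Fin 3 ⊕ (Fin 3 × Fin 3) → ℕ
  | .inl i => 3 * i
  | .inr (i, j) => 3 * j + if i = j + 1 then 1 else 2

/-- The order in which the labels occur among the sorted columns. -/
def colPos : Fin 3 ⊕ (Fin 3 × Fin 3) → ℕ
  | .inl i => 3 * i
  | .inr (i, j) => 3 * i + if j = i + 2 then 1 else 2

/-- Expresses a position in a three-part block by linear conditions on its sub-block code `P` and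
offset `O`, so that comparing positions becomes linear arithmetic. -/
theorem lex_lt_iff_of_blockEquiv {K a b i P O : ℕ} (p : Fin (K + (a + b)))
    (h0 : ∀ u, blockEquiv K a b p = .inl u → P = 3 * i ∧ O = u)
    (h1 : ∀ u, blockEquiv K a b p = .inr (.inl u) → P = 3 * i + 1 ∧ O = u)
    (h2 : ∀ u, blockEquiv K a b p = .inr (.inr u) → P = 3 * i + 2 ∧ O = u) :
    (P = 3 * i ∧ p = O ∧ O < K) ∨ (P = 3 * i + 1 ∧ p = K + O ∧ O < a) ∨
      (P = 3 * i + 2 ∧ p = K + a + O) := by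
  obtain ⟨s, rfl⟩ := (blockEquiv K a b).symm.surjective p
  rcases s with u | u | u
  · obtain ⟨rfl, rfl⟩ := h0 u (by simp)
    exact Or.inl ⟨rfl, rfl, u.2⟩
  · obtain ⟨rfl, rfl⟩ := h1 u (by simp)
    exact Or.inr (Or.inl ⟨rfl, rfl, u.2⟩)
  · obtain ⟨rfl, rfl⟩ := h2 u (by simp)
    refine Or.inr (Or.inr ⟨rfl, ?_⟩)
    change K + (a + (u : ℕ)) = _
    omega

theorem rowPos_rowEquiv (hr : ∀ i, r i i = 0) (i : Fin 3) (p : Fin (k i + (r (i + 1) i + r (i + 2) i))) :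
    let x := rowEquiv (k := k) hr ⟨i, p⟩
    (rowPos (label x) = 3 * i ∧ p = offset x ∧ offset x < k i) ∨
      (rowPos (label x) = 3 * i + 1 ∧ p = k i + offset x ∧ offset x < r (i + 1) i) ∨
      (rowPos (label x) = 3 * i + 2 ∧ p = k i + r (i + 1) i + offset x) := by
  intro x
  refine lex_lt_iff_of_blockEquiv p ?_ ?_ ?_ <;> intro u hu <;>
    simp [x, rowEquiv_apply, hu, rowMap, label, offset, rowPos, (add_one_ne_add_two i).symm]

theorem colPos_colEquiv (hr : ∀ i, r i i = 0)
    (hb : ∀ i, r i (i + 2) + r i (i + 1) = r (i + 1) i + r (i + 2) i)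
    (i : Fin 3) (p : Fin (k i + (r (i + 1) i + r (i + 2) i))) :
    let x := colEquiv (k := k) hr hb ⟨i, p⟩
    (colPos (label x) = 3 * i ∧ p = offset x ∧ offset x < k i) ∨
      (colPos (label x) = 3 * i + 1 ∧ p = k i + offset x ∧ offset x < r i (i + 2)) ∨
      (colPos (label x) = 3 * i + 2 ∧ p = k i + r i (i + 2) + offset x) := by
  intro x
  refine lex_lt_iff_of_blockEquiv (Fin.cast (congrArg (k i + ·) (hb i)).symm p) ?_ ?_ ?_ <;>
    intro u hu <;>
    simp [x, colEquiv_apply, hu, colMap, label, offset, colPos, add_one_ne_add_two i]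

/-- The lexicographic key of an index of a sorted matrix. -/
def sigmaKey {n : Fin 3 → ℕ} (x : Σ i, Fin (n i)) : ℕ ×ₗ ℕ := toLex ((x.1 : ℕ), (x.2 : ℕ))

theorem sigmaKey_injective {n : Fin 3 → ℕ} : Function.Injective (sigmaKey (n := n)) := by
  rintro ⟨i, p⟩ ⟨j, q⟩ h
  have h' := toLex.injective h
  simp only [Prod.mk.injEq] at h'
  obtain ⟨h1, h2⟩ := h'
  obtain rfl := Fin.ext h1
  rw [Fin.ext h2]

theorem sigmaKey_lt_iff {n : Fin 3 → ℕ} (x y : Σ i, Fin (n i)) :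
    sigmaKey x < sigmaKey y ↔ (x.1 : ℕ) < y.1 ∨ (x.1 : ℕ) = y.1 ∧ (x.2 : ℕ) < y.2 :=
  Prod.Lex.toLex_lt_toLex

theorem sigmaKey_lt_iff_rowPos (hr : ∀ i, r i i = 0) (x y) :
    sigmaKey x < sigmaKey y ↔
      rowPos (label (rowEquiv (k := k) hr x)) < rowPos (label (rowEquiv (k := k) hr y)) ∨
      rowPos (label (rowEquiv (k := k) hr x)) = rowPos (label (rowEquiv (k := k) hr y)) ∧
        offset (rowEquiv (k := k) hr x) < offset (rowEquiv (k := k) hr y) := by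
  obtain ⟨i, p⟩ := x
  obtain ⟨j, q⟩ := y
  rw [sigmaKey_lt_iff]
  have h1 := rowPos_rowEquiv hr i p
  have h2 := rowPos_rowEquiv hr j q
  simp only at h1 h2 ⊢
  by_cases hij : i = j
  · subst hij
    omega
  · have : (i : ℕ) ≠ j := fun h => hij (Fin.ext h)
    omega

theorem sigmaKey_lt_iff_colPos (hr : ∀ i, r i i = 0)
    (hb : ∀ i, r i (i + 2) + r i (i + 1) = r (i + 1) i + r (i + 2) i) (x y) :
    sigmaKey x < sigmaKey y ↔
      colPos (label (colEquiv (k := k) hr hb x)) < colPos (label (colEquiv (k := k) hr hb y)) ∨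
      colPos (label (colEquiv (k := k) hr hb x)) = colPos (label (colEquiv (k := k) hr hb y)) ∧
        offset (colEquiv (k := k) hr hb x) < offset (colEquiv (k := k) hr hb y) := by
  obtain ⟨i, p⟩ := x
  obtain ⟨j, q⟩ := y
  rw [sigmaKey_lt_iff]
  have h1 := colPos_colEquiv hr hb i p
  have h2 := colPos_colEquiv hr hb j q
  simp only at h1 h2 ⊢
  by_cases hij : i = j
  · subst hij
    omega
  · have : (i : ℕ) ≠ j := fun h => hij (Fin.ext h)
    omega

/-- Whether two labels occur in opposite order among the rows and among the columns. -/
def inversion (β β' : Fin 3 ⊕ (Fin 3 × Fin 3)) : ℕ :=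
  if rowPos β < rowPos β' ∧ colPos β' < colPos β then 1 else 0

/-- Labels `(i, i)` must be excluded: they fall into the default branches of `rowPos` and `colPos`
and share their positions with `(i + 2, i)` and `(i, i + 1)`. -/
theorem inversion_iff (β β' : Fin 3 ⊕ (Fin 3 × Fin 3)) (hβ : ∀ i, β ≠ .inr (i, i))
    (hβ' : ∀ i, β' ≠ .inr (i, i)) :
    (rowPos β = rowPos β' ↔ β = β') ∧ (colPos β' = colPos β ↔ β = β') := by
  revert β β'
  decide

theorem label_ne (hr : ∀ i, r i i = 0) (x : BorderedIndex k r) (i : Fin 3) :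
    label x ≠ .inr (i, i) := by
  rcases x with x | ⟨z, x⟩
  · simp [label]
  · rintro h
    obtain rfl : z = (i, i) := by simpa [label] using h
    exact absurd x.2 (by simp [hr])

/-- Indices with the same label keep their relative order in both sortings. All inversions therefore
come from distinct labels, and they depend on the labels alone. -/
theorem sign_row_col (hr : ∀ i, r i i = 0)
    (hb : ∀ i, r i (i + 2) + r i (i + 1) = r (i + 1) i + r (i + 2) i) :
    (Equiv.Perm.sign ((rowEquiv (k := k) hr).trans (colEquiv hr hb).symm) : ℤ) =
      (-1) ^ (∑ x : BorderedIndex k r, ∑ y : BorderedIndex k r, inversion (label x) (label y)) := by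
  rw [sign_eq_prod_inversions sigmaKey_injective, ← Finset.prod_pow_eq_pow_sum,
    ← (rowEquiv (k := k) hr).prod_comp]
  refine Finset.prod_congr rfl fun x _ => ?_
  rw [← Finset.prod_pow_eq_pow_sum, ← (rowEquiv (k := k) hr).prod_comp]
  refine Finset.prod_congr rfl fun y _ => ?_
  obtain ⟨e1, e2⟩ := inversion_iff (label (rowEquiv (k := k) hr x)) (label (rowEquiv (k := k) hr y))
    (label_ne hr _) (label_ne hr _)
  have h : (sigmaKey x < sigmaKey y ∧
      sigmaKey (((rowEquiv (k := k) hr).trans (colEquiv hr hb).symm) y) <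
        sigmaKey (((rowEquiv (k := k) hr).trans (colEquiv hr hb).symm) x)) ↔
      rowPos (label (rowEquiv (k := k) hr x)) < rowPos (label (rowEquiv (k := k) hr y)) ∧
        colPos (label (rowEquiv (k := k) hr y)) < colPos (label (rowEquiv (k := k) hr x)) := by
    rw [sigmaKey_lt_iff_rowPos hr, sigmaKey_lt_iff_colPos hr hb]
    simp only [Equiv.trans_apply, Equiv.apply_symm_apply]
    rw [e1, e2]
    constructor
    · rintro ⟨h1 | ⟨h1, h1'⟩, h2 | ⟨h2, h2'⟩⟩
      · exact ⟨h1, h2⟩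
      · rw [h2] at h1; omega
      · rw [h1] at h2; omega
      · omega
    · exact fun h => ⟨Or.inl h.1, Or.inl h.2⟩
  rw [if_congr h rfl rfl, inversion]
  split_ifs <;> simp

theorem sum_inversion_eq (hr : ∀ i, r i i = 0) :
    ∑ x : BorderedIndex k r, ∑ y : BorderedIndex k r, inversion (label x) (label y) =
      k 1 * (r 0 1 + r 0 2) + k 2 * (r 0 2 + r 1 2) + r 0 1 * r 0 2 +
        r 1 0 * (k 1 + r 0 1 + r 0 2) + r 2 0 * (k 1 + k 2 + r 0 1 + r 0 2 + r 1 2 + r 2 1) +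
        r 2 1 * (k 2 + r 0 1 + r 0 2 + r 1 2) := by
  simp only [Fintype.sum_sum_type, Fintype.sum_sigma, label, Finset.sum_const, Finset.card_univ,
    Fintype.card_fin, smul_eq_mul, Fintype.sum_prod_type, Fin.sum_univ_three, hr]
  simp [inversion, rowPos, colPos]
  ring

/-- Here `A, B, C` stand for `r^{12}, r^{23}, r^{31}` and `a, b, c` for `r^{21}, r^{32}, r^{13}`;
the summand `A + B + C` is the sign contributed by the couplings. The balance conditions make the
coefficients of `k₁` and `k₂` even, which is why the final sign does not involve the diagonal
lengths. -/
theorem even_inversions_iff {k₁ k₂ a b c A B C : ℕ} (h0 : c + A = a + C) (h1 : a + B = b + A) :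
    Even (k₁ * (A + c) + k₂ * (c + B) + A * c + a * (k₁ + A + c) + C * (k₁ + k₂ + A + c + B + b) +
        b * (k₂ + A + c + B) + (A + B + C)) ↔
      Even (c * a + a * b + b * c + A + a) := by
  have e0 : (Even c ↔ Even A) ↔ (Even a ↔ Even C) := by rw [← Nat.even_add, ← Nat.even_add, h0]
  have e1 : (Even a ↔ Even B) ↔ (Even b ↔ Even A) := by rw [← Nat.even_add, ← Nat.even_add, h1]
  simp only [Nat.even_add, Nat.even_mul]
  clear h0 h1
  generalize Even c = pc at *
  generalize Even a = pa at *
  generalize Even b = pb at *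
  generalize Even A = pA at *
  generalize Even B = pB at *
  generalize Even C = pC at *
  generalize Even k₁ = q1 at *
  generalize Even k₂ = q2 at *
  -- The parities of `B` and `C` are determined by the others through `e0` and `e1`.
  by_cases pc <;> by_cases pa <;> by_cases pb <;> by_cases pA <;> by_cases q1 <;> by_cases q2 <;>
    simp_all

variable {K : Type*} [NormedField K]

theorem sign_mul_prod_coupling (hr : ∀ i, r i i = 0)
    (hb : ∀ i, r i (i + 2) + r i (i + 1) = r (i + 1) i + r (i + 2) i) {v : K} (hv : v ≠ 0) :
    ((Equiv.Perm.sign ((rowEquiv (k := k) hr).trans (colEquiv hr hb).symm) : ℤ) : K) *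
      ∏ z : Fin 3 × Fin 3, (-coupling v z.1 z.2) ^ r z.1 z.2 =
      (-1) ^ (r 0 2 * r 1 0 + r 1 0 * r 2 1 + r 2 1 * r 0 2 + r 0 1 + r 1 0) *
        v ^ (2 * ((r 0 1 : ℤ) + r 1 2 + r 2 0 - r 1 0 - r 2 1 - r 0 2)) := by
  have h1 : ∏ z : Fin 3 × Fin 3, (-coupling v z.1 z.2) ^ r z.1 z.2 =
      (-1) ^ (r 0 1 + r 1 2 + r 2 0) *
        v ^ (2 * ((r 0 1 : ℤ) + r 1 2 + r 2 0 - r 1 0 - r 2 1 - r 0 2)) := by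
    have hpow : ∀ (m : ℤ) (n : ℕ), (v ^ m) ^ n = v ^ (m * n) := fun m n => by
      rw [zpow_mul, zpow_natCast]
    have e1 : ∀ n : ℕ, (-v ^ (2 : ℤ)) ^ n = (-1) ^ n * v ^ (2 * (n : ℤ)) := fun n => by
      rw [neg_pow, hpow]
    have c01 : coupling v 0 1 = v ^ (2 : ℤ) := rfl
    have c12 : coupling v 1 2 = v ^ (2 : ℤ) := rfl
    have c20 : coupling v 2 0 = v ^ (2 : ℤ) := rfl
    have c10 : coupling v 1 0 = -v ^ (-2 : ℤ) := rfl
    have c21 : coupling v 2 1 = -v ^ (-2 : ℤ) := rfl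
    have c02 : coupling v 0 2 = -v ^ (-2 : ℤ) := rfl
    simp only [Fintype.prod_prod_type, Fin.prod_univ_three, hr, pow_zero, c01, c12, c20, c10, c21,
      c02, neg_neg, e1, hpow]
    rw [show 2 * ((r 0 1 : ℤ) + r 1 2 + r 2 0 - r 1 0 - r 2 1 - r 0 2) =
      2 * (r 0 1 : ℤ) + -2 * (r 0 2 : ℤ) + -2 * (r 1 0 : ℤ) + 2 * (r 1 2 : ℤ) + 2 * (r 2 0 : ℤ) +
        -2 * (r 2 1 : ℤ) by ring]
    simp only [zpow_add₀ hv, pow_add]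
    ring
  have b0 : r 0 2 + r 0 1 = r 1 0 + r 2 0 := hb 0
  have b1 : r 1 0 + r 1 2 = r 2 1 + r 0 1 := hb 1
  rw [h1, sign_row_col hr hb, sum_inversion_eq hr, Int.cast_pow, Int.cast_neg, Int.cast_one,
    ← mul_assoc, ← pow_add]
  congr 1
  exact neg_one_pow_congr (even_inversions_iff b0 b1)

end Blocks

/-! ### Bordered minors and the summation indices -/

section Expansion

open Matrix

variable {K : Type*} [NormedField K] (v : K) (μ : Fin 3 → YoungDiagram)

/-- The block diagonal matrix of hook Schur functions. -/
noncomputable def hookSchurMatrix : Matrix (Hooks μ) (Hooks μ) K :=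
  of fun x y => if y.1 = x.1 then sBar v x.arm y.leg else 0

/-- The matrix of hook Schur functions with bordering rows and columns indexed by `T`, where `t : T`
is attached to the pair `z t` and the number `l t`. -/
noncomputable def borderedMatrix {T : Type*} (z : T → Fin 3 × Fin 3) (l : T → ℕ) :
    Matrix (Hooks μ ⊕ T) (Hooks μ ⊕ T) K :=
  fromBlocks (hookSchurMatrix v μ)
    (of fun x t => if x.1 = (z t).1 then colEntry v (z t).1 (z t).2 x.arm (l t) else 0)
    (of fun t y => if y.1 = (z t).2 then rowEntry v (z t).1 (z t).2 y.leg (l t) else 0) 0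

/-- An index `((i, j), l)` with `l < N` of a bordering row and column. -/
abbrev BorderLabel (N : ℕ) : Type := (Fin 3 × Fin 3) × Fin N

/-- The contribution of a set of bordering rows and columns. -/
noncomputable def minorTerm {N : ℕ} (T : Finset (BorderLabel N)) : K :=
  (∏ t ∈ T, -coupling v t.1.1 t.1.2) *
    (borderedMatrix v μ (fun t : T => t.1.1) (fun t : T => (t.1.2 : ℕ))).det

theorem det_coreEntry (N : ℕ) :
    (of fun x y : Hooks μ => coreEntry v N x.1 y.1 x.arm y.leg).det =
      ∑ T : Finset (BorderLabel N), minorTerm v μ T := by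
  have h := det_add_mul_diagonal_mul (hookSchurMatrix v μ)
    (of fun (x : Hooks μ) (t : BorderLabel N) =>
      if x.1 = t.1.1 then colEntry v t.1.1 t.1.2 x.arm t.2 else 0)
    (fun t => coupling v t.1.1 t.1.2)
    (of fun (t : BorderLabel N) (y : Hooks μ) =>
      if y.1 = t.1.2 then rowEntry v t.1.1 t.1.2 y.leg t.2 else 0)
  refine Eq.trans ?_ h
  congr 1
  ext x y
  rw [Matrix.add_apply, Matrix.mul_apply]
  simp only [of_apply, Matrix.mul_diagonal, hookSchurMatrix, coreEntry]
  congr 1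
  -- Only inner labels attached to the pair of components of `x` and `y` give a nonzero product.
  rw [Fintype.sum_prod_type, Finset.sum_eq_single (x.1, y.1)]
  · refine Finset.sum_congr rfl fun l _ => ?_
    simp only [if_true]
    ring
  · rintro ⟨i, j⟩ - hij
    refine Finset.sum_eq_zero fun l _ => ?_
    by_cases h1 : x.1 = i
    · by_cases h2 : y.1 = j
      · exact absurd (by rw [h1, h2]) hij
      · simp [h2]
    · simp [h1]
  · simp

theorem borderedMatrix_submatrix {T T' : Type*} (z : T → Fin 3 × Fin 3) (l : T → ℕ) (e : T' → T) :
    (borderedMatrix v μ z l).submatrix (Sum.map id e) (Sum.map id e) =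
      borderedMatrix v μ (z ∘ e) (l ∘ e) := by
  ext (x | x) (y | y) <;> rfl

variable {μ}

/-- The bordering sequences of a summation index, as a matrix. -/
noncomputable def indexMatrix (J : SumIndex fun i => diagLen (μ i)) :
    Matrix (BorderedIndex (fun i => diagLen (μ i)) J.r) (BorderedIndex (fun i => diagLen (μ i)) J.r) K :=
  borderedMatrix v μ (fun t : Σ z : Fin 3 × Fin 3, Fin (J.r z.1 z.2) => t.1)
    (fun t => J.seq t.1.1 t.1.2 t.2)

theorem self_ne_add_one_add_one (i : Fin 3) : i ≠ i + 1 + 1 := by revert i; decide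

theorem indexMatrix_rowMap_colMap (J : SumIndex fun i => diagLen (μ i)) (i : Fin 3) (s t) :
    indexMatrix v J (rowMap _ _ ⟨i, s⟩) (colMap _ _ ⟨i, t⟩) = blockMatrix v μ J i s t := by
  have h1 := add_one_ne_add_two i
  have e1 := self_ne_add_one_add_one i
  rcases s with s | s | s <;> rcases t with t | t | t
  · simp [indexMatrix, borderedMatrix, rowMap, colMap, blockMatrix, hookSchurMatrix, Hooks.arm, Hooks.leg]
  · simp [indexMatrix, borderedMatrix, rowMap, colMap, blockMatrix, colEntry, Hooks.arm, h1.symm]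
  · simp [indexMatrix, borderedMatrix, rowMap, colMap, blockMatrix, colEntry, Hooks.arm]
  · simp [indexMatrix, borderedMatrix, rowMap, colMap, blockMatrix, rowEntry, Hooks.leg, e1,
      add_one_add_two]
  · rfl
  · rfl
  · simp [indexMatrix, borderedMatrix, rowMap, colMap, blockMatrix, rowEntry, Hooks.leg,
      add_two_add_one]
  · rfl
  · rfl

theorem indexMatrix_of_ne (J : SumIndex fun i => diagLen (μ i)) {i j : Fin 3} (hij : i ≠ j) (s t) :
    indexMatrix v J (rowMap _ _ ⟨i, s⟩) (colMap _ _ ⟨j, t⟩) = 0 := by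
  rcases s with s | s | s <;> rcases t with t | t | t <;>
    simp [indexMatrix, borderedMatrix, rowMap, colMap, hookSchurMatrix, hij, hij.symm]

theorem det_indexMatrix (J : SumIndex fun i => diagLen (μ i)) :
    (indexMatrix v J).det =
      ((Equiv.Perm.sign ((rowEquiv (k := fun i => diagLen (μ i)) J.r_diag).trans
        (colEquiv J.r_diag J.balance).symm) : ℤ) : K) * ∏ i, blockDet v μ J i := by
  rw [det_eq_sign_mul_prod_det (rowEquiv J.r_diag) (colEquiv J.r_diag J.balance)]
  · congr 1
    refine Finset.prod_congr rfl fun i _ => ?_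
    rw [blockDet]
    congr 1
    ext p q
    exact indexMatrix_rowMap_colMap v J i _ _
  · intro i j p q hij
    exact indexMatrix_of_ne v J hij _ _

/-- The set of bordering labels of a summation index. -/
def SumIndex.labels (N : ℕ) {k : Fin 3 → ℕ} (J : SumIndex k) : Finset (BorderLabel N) :=
  Finset.univ.filter fun p => ∃ t, J.seq p.1.1 p.1.2 t = p.2

/-- The bordering sequences are bounded by `N`. -/
def SumIndex.IsBounded (N : ℕ) {k : Fin 3 → ℕ} (J : SumIndex k) : Prop :=
  ∀ i j t, J.seq i j t < N

theorem SumIndex.mem_labels {N : ℕ} {k : Fin 3 → ℕ} {J : SumIndex k} {p : BorderLabel N} :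
    p ∈ J.labels N ↔ ∃ t, J.seq p.1.1 p.1.2 t = p.2 := by
  simp [SumIndex.labels]

/-- The labels of a bounded summation index, numbered by its sequences. -/
noncomputable def SumIndex.labelEquiv {N : ℕ} {k : Fin 3 → ℕ} {J : SumIndex k} (hJ : J.IsBounded N) :
    (Σ z : Fin 3 × Fin 3, Fin (J.r z.1 z.2)) ≃ J.labels N :=
  Equiv.ofBijective (fun t => ⟨(t.1, ⟨J.seq t.1.1 t.1.2 t.2, hJ _ _ _⟩), mem_labels.2 ⟨t.2, rfl⟩⟩) (by
    constructor
    · rintro ⟨z, s⟩ ⟨z', t⟩ h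
      simp only [Subtype.mk.injEq, Prod.mk.injEq, Fin.mk.injEq] at h
      obtain ⟨rfl, h⟩ := h
      rw [(J.seq_anti _ _).injective h]
    · rintro ⟨⟨z, l⟩, h⟩
      obtain ⟨t, ht⟩ := mem_labels.1 h
      exact ⟨⟨z, t⟩, Subtype.ext (Prod.ext rfl (Fin.ext ht))⟩)

theorem minorTerm_labels {N : ℕ} {J : SumIndex fun i => diagLen (μ i)} (hJ : J.IsBounded N)
    (hv : v ≠ 0) :
    minorTerm v μ (J.labels N) =
      (-1) ^ (J.r 0 2 * J.r 1 0 + J.r 1 0 * J.r 2 1 + J.r 2 1 * J.r 0 2 + J.r 0 1 + J.r 1 0) *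
        v ^ (2 * ((J.r 0 1 : ℤ) + J.r 1 2 + J.r 2 0 - J.r 1 0 - J.r 2 1 - J.r 0 2)) *
        ∏ i, blockDet v μ J i := by
  have h1 : ∏ t ∈ J.labels N, -coupling v t.1.1 t.1.2 =
      ∏ z : Fin 3 × Fin 3, (-coupling v z.1 z.2) ^ J.r z.1 z.2 := by
    rw [← Finset.prod_coe_sort, ← (SumIndex.labelEquiv hJ).prod_comp, Fintype.prod_sigma]
    refine Finset.prod_congr rfl fun z _ => ?_
    change ∏ _t : Fin (J.r z.1 z.2), (-coupling v z.1 z.2) = _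
    rw [Finset.prod_const, Finset.card_univ, Fintype.card_fin]
  have h2 : (borderedMatrix v μ (fun t : J.labels N => t.1.1) (fun t => (t.1.2 : ℕ))).det =
      (indexMatrix v J).det := by
    rw [← det_submatrix_equiv_self (Equiv.sumCongr (Equiv.refl (Hooks μ)) (SumIndex.labelEquiv hJ))]
    congr 1
    exact borderedMatrix_submatrix v μ _ _ (SumIndex.labelEquiv hJ)
  rw [minorTerm, h1, h2, det_indexMatrix, ← mul_assoc,
    mul_comm (∏ z : Fin 3 × Fin 3, _) _, sign_mul_prod_coupling J.r_diag J.balance hv]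

/-- A term `l ≥ N` exceeds all arms, so its bordering column consists of `e` or `h` at negative
degree, or of zeros. The whole matrix is then singular, and since the sorting sign is a unit, the
product of the blocks vanishes. -/
theorem prod_blockDet_eq_zero {N : ℕ} (hN : ∀ x : Hooks μ, x.arm < N)
    {J : SumIndex fun i => diagLen (μ i)} (hJ : ¬ J.IsBounded N) : ∏ i, blockDet v μ J i = 0 := by
  have h := det_indexMatrix v J
  simp only [SumIndex.IsBounded, not_forall, not_lt] at hJ
  obtain ⟨i, j, t, ht⟩ := hJ
  rw [det_eq_zero_of_column_eq_zero (Sum.inr ⟨(i, j), t⟩)] at h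
  · rcases mul_eq_zero.1 h.symm with h | h
    · rcases Int.units_eq_one_or (Equiv.Perm.sign ((rowEquiv (k := fun i => diagLen (μ i))
        J.r_diag).trans (colEquiv J.r_diag J.balance).symm)) with h' | h' <;> simp [h'] at h
    · exact h
  · rintro (x | x)
    · simp [indexMatrix, borderedMatrix, colEntry_of_lt v i j ((hN x).trans_le ht)]
    · rfl

theorem sum_fin_three {M : Type*} [AddCommMonoid M] (f : Fin 3 → M) (i : Fin 3) :
    ∑ j, f j = f i + (f (i + 1) + f (i + 2)) := by
  rw [Fin.sum_univ_three]
  fin_cases i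
  · exact add_assoc _ _ _
  · change f 0 + f 1 + f 2 = f 1 + (f 2 + f 0)
    abel
  · change f 0 + f 1 + f 2 = f 2 + (f 0 + f 1)
    abel

theorem sum_ite_fst_eq (i : Fin 3) : (∑ h : Hooks μ, if h.1 = i then 1 else 0) = diagLen (μ i) := by
  rw [Fintype.sum_sigma, Finset.sum_eq_single i]
  · simp
  · intro j _ hj
    simp [hj]
  · simp

/-- A nonzero determinant has a permutation meeting only nonzero entries, and these join rows and
columns of the same component. Counting rows and columns of component `i` gives the balance. The
zero corner forces bordering rows onto ordinary columns, which gives the bound. A label `(i, i)` is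
impossible because its bordering column is zero. -/
theorem exists_sumIndex_of_minorTerm_ne_zero {N : ℕ} {T : Finset (BorderLabel N)}
    (h : minorTerm v μ T ≠ 0) :
    ∃ J : SumIndex fun i => diagLen (μ i), J.IsBounded N ∧ J.labels N = T := by
  obtain ⟨σ, hσ⟩ := exists_perm_of_det_ne_zero (right_ne_zero_of_mul h)
  set M := borderedMatrix v μ (fun t : T => t.1.1) (fun t : T => (t.1.2 : ℕ)) with hM
  let F : Fin 3 → Fin 3 → Finset ℕ := fun i j =>
    (T.filter fun p => p.1 = (i, j)).image fun p => (p.2 : ℕ)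
  have memF : ∀ i j l, l ∈ F i j ↔ ∃ hl : l < N, ((i, j), ⟨l, hl⟩) ∈ T := by
    intro i j l
    simp only [F, Finset.mem_image, Finset.mem_filter]
    constructor
    · rintro ⟨⟨z, l⟩, ⟨h1, rfl⟩, rfl⟩
      exact ⟨l.2, h1⟩
    · rintro ⟨hl, h1⟩
      exact ⟨_, ⟨h1, rfl⟩, rfl⟩
  have cardF : ∀ i j, (F i j).card = ∑ p ∈ T, if p.1 = (i, j) then 1 else 0 := by
    intro i j
    rw [Finset.card_image_of_injOn, Finset.card_filter]
    rintro ⟨z, l⟩ h1 ⟨z', l'⟩ h2 h3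
    simp only [Finset.coe_filter, Set.mem_ofPred_eq] at h1 h2 h3
    exact Prod.ext (h1.2.trans h2.2.symm) (Fin.ext h3)
  have sumRow : ∀ i, ∑ j, (F j i).card = ∑ t : T, if t.1.1.2 = i then 1 else 0 := by
    intro i
    simp only [cardF]
    rw [Finset.sum_comm, Finset.sum_coe_sort T fun p => if p.1.2 = i then 1 else 0]
    refine Finset.sum_congr rfl fun p _ => ?_
    obtain ⟨⟨a, b⟩, l⟩ := p
    by_cases hb : b = i <;> simp [hb]
  have sumCol : ∀ i, ∑ j, (F i j).card = ∑ t : T, if t.1.1.1 = i then 1 else 0 := by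
    intro i
    simp only [cardF]
    rw [Finset.sum_comm, Finset.sum_coe_sort T fun p => if p.1.1 = i then 1 else 0]
    refine Finset.sum_congr rfl fun p _ => ?_
    obtain ⟨⟨a, b⟩, l⟩ := p
    by_cases hb : a = i <;> simp [hb]
  have hdiag : ∀ i, (F i i).card = 0 := by
    intro i
    rw [Finset.card_eq_zero, Finset.eq_empty_iff_forall_notMem]
    intro l hl
    obtain ⟨hl, hT⟩ := (memF i i l).1 hl
    refine hσ (Sum.inr ⟨_, hT⟩) ?_
    rcases σ (Sum.inr ⟨_, hT⟩) with x | x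
    · simp [hM, borderedMatrix, colEntry]
    · rfl
  have hlabel : ∀ x y, M x y ≠ 0 →
      Sum.elim (fun h => h.1) (fun t => t.1.1.2) x = Sum.elim (fun h => h.1) (fun t => t.1.1.1) y := by
    rintro (x | x) (y | y) hxy <;> by_contra hne <;> apply hxy
    · exact if_neg (Ne.symm hne)
    · exact if_neg hne
    · exact if_neg (Ne.symm hne)
    · rfl
  have hbal : ∀ i, ∑ j, (F i j).card = ∑ j, (F j i).card := by
    intro i
    have h1 := Equiv.sum_comp σ fun x : Hooks μ ⊕ T =>
      if Sum.elim (fun h => h.1) (fun t => t.1.1.2) x = i then 1 else 0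
    simp only [hlabel _ _ (hσ _)] at h1
    rw [Fintype.sum_sum_type, Fintype.sum_sum_type] at h1
    simp only [Sum.elim_inl, Sum.elim_inr] at h1
    rw [sumRow, sumCol]
    exact Nat.add_left_cancel h1
  have hbound : ∀ i, ∑ j, (F j i).card ≤ diagLen (μ i) := by
    intro i
    have h1 := Equiv.sum_comp σ fun x : Hooks μ ⊕ T => Sum.elim (fun _ => 0)
      (fun t => if t.1.1.2 = i then 1 else 0) x
    have h2 : ∑ y, (Sum.elim (fun _ => 0) (fun t : T => if t.1.1.2 = i then 1 else 0) (σ y) : ℕ) ≤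
        ∑ y : Hooks μ ⊕ T, Sum.elim (fun h => if h.1 = i then 1 else 0) (fun _ => 0) y := by
      refine Finset.sum_le_sum fun y _ => ?_
      have h3 := hlabel _ _ (hσ y)
      have h4 := hσ y
      rcases hx : σ y with x | x
      · simp
      · rw [hx] at h3 h4
        rcases y with y | y
        · simp only [Sum.elim_inl, Sum.elim_inr] at h3 ⊢
          rw [h3]
        · exact absurd rfl h4
    rw [h1, Fintype.sum_sum_type, Fintype.sum_sum_type] at h2
    simp only [Sum.elim_inl, Sum.elim_inr, Finset.sum_const_zero, zero_add, add_zero] at h2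
    rw [sumRow, ← sum_ite_fst_eq]
    exact h2
  have hrow : ∀ i, ∑ j, (F j i).card = (F (i + 1) i).card + (F (i + 2) i).card := fun i => by
    rw [sum_fin_three (fun j => (F j i).card) i, hdiag, zero_add]
  have hcol : ∀ i, ∑ j, (F i j).card = (F i (i + 2)).card + (F i (i + 1)).card := fun i => by
    rw [sum_fin_three (fun j => (F i j).card) i, hdiag, zero_add, add_comm]
  let J : SumIndex fun i => diagLen (μ i) :=
    { r := fun i j => (F i j).card
      r_diag := hdiag
      -- The order embedding enumerates increasingly; `rev` makes the sequence decreasing.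
      seq := fun i j t => (F i j).orderEmbOfFin rfl t.rev
      seq_anti := fun i j s t hst => ((F i j).orderEmbOfFin rfl).strictMono (Fin.rev_lt_rev.2 hst)
      balance := fun i => by rw [← hcol, ← hrow, hbal]
      bound := fun i => by rw [← hcol, hbal]; exact hbound i }
  have hseq : ∀ i j l, (∃ t, J.seq i j t = l) ↔ l ∈ F i j := by
    intro i j l
    have hr : l ∈ Set.range ((F i j).orderEmbOfFin rfl) ↔ l ∈ F i j := by
      rw [Finset.range_orderEmbOfFin, Finset.mem_coe]
    rw [← hr]
    exact ⟨fun ⟨t, ht⟩ => ⟨t.rev, ht⟩, fun ⟨t, ht⟩ => ⟨t.rev, by simpa [J] using ht⟩⟩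
  refine ⟨J, fun i j t => ((memF i j _).1 ((hseq i j _).1 ⟨t, rfl⟩)).1, ?_⟩
  ext ⟨⟨i, j⟩, l⟩
  rw [SumIndex.mem_labels, hseq, memF]
  exact ⟨fun ⟨_, h⟩ => h, fun h => ⟨l.2, h⟩⟩

/-- A strictly decreasing finite sequence is determined by its set of values, and its length by
their number. -/
theorem SumIndex.labels_injOn (N : ℕ) (k : Fin 3 → ℕ) :
    Set.InjOn (SumIndex.labels N) {J : SumIndex k | J.IsBounded N} := by
  rintro ⟨r, hr, seq, hs, hb, hbd⟩ h1 ⟨r', hr', seq', hs', hb', hbd'⟩ h2 h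
  have hrange : ∀ i j, Set.range (seq i j) = Set.range (seq' i j) := by
    intro i j
    ext l
    constructor
    · rintro ⟨t, rfl⟩
      have : (((i, j), ⟨seq i j t, h1 i j t⟩) : BorderLabel N) ∈ SumIndex.labels N ⟨r, hr, seq, hs, hb, hbd⟩ := mem_labels.2 ⟨t, rfl⟩
      rw [h] at this
      exact mem_labels.1 this
    · rintro ⟨t, rfl⟩
      have : (((i, j), ⟨seq' i j t, h2 i j t⟩) : BorderLabel N) ∈
          SumIndex.labels N ⟨r', hr', seq', hs', hb', hbd'⟩ := mem_labels.2 ⟨t, rfl⟩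
      rw [← h] at this
      exact mem_labels.1 this
  have hcard : r = r' := by
    funext i j
    have e1 : (Set.range (seq i j)).ncard = r i j := by
      rw [← Set.image_univ, Set.ncard_image_of_injective _ (hs i j).injective, Set.ncard_univ]
      simp
    have e2 : (Set.range (seq' i j)).ncard = r' i j := by
      rw [← Set.image_univ, Set.ncard_image_of_injective _ (hs' i j).injective, Set.ncard_univ]
      simp
    rw [← e1, ← e2, hrange]
  subst hcard
  have hseq : seq = seq' := by
    funext i j
    exact (StrictAnti.range_inj (hs i j) (hs' i j)).1 (hrange i j)
  subst hseq
  rfl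

end Expansion

/-! ### Framing factor and the determinantal formula -/

section DeterminantalFormula

open Matrix

theorem finsum_eq_finsum_mem_of_support_subset {α M : Type*} [AddCommMonoid M] {f : α → M}
    {s : Set α} (h : Function.support f ⊆ s) : ∑ᶠ x, f x = ∑ᶠ x ∈ s, f x := by
  rw [← finsum_mem_univ]
  exact finsum_mem_inter_support_eq' f _ _ fun x hx => iff_of_true (Set.mem_univ x) (h hx)

variable {K : Type*} [NormedField K]

theorem prod_zpow_eq_zpow_sum {ι : Type*} {v : K} (hv : v ≠ 0) (s : Finset ι) (f : ι → ℤ) :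
    ∏ x ∈ s, v ^ f x = v ^ ∑ x ∈ s, f x := by
  classical
  induction s using Finset.induction_on with
  | empty => simp
  | insert x s hx ih => rw [Finset.prod_insert hx, Finset.sum_insert hx, ih, zpow_add₀ hv]

/-- The exponent of the framing factor. -/
def framingExponent (a : Fin 3 → ℤ) (μ : Fin 3 → YoungDiagram) : ℤ :=
  ∑ i : Fin 3, ∑ t ∈ Finset.range (diagLen (μ i)),
    6 * (a i * ((arm (μ i) t : ℤ) * (arm (μ i) t + 1) - (leg (μ i) t : ℤ) * (leg (μ i) t + 1)))

theorem sum_hooks_eq_framingExponent (a : Fin 3 → ℤ) (μ : Fin 3 → YoungDiagram) :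
    ∑ x : Hooks μ, 6 * (a x.1 * ((x.arm : ℤ) * (x.arm + 1))) +
      ∑ x : Hooks μ, -(6 * (a x.1 * ((x.leg : ℤ) * (x.leg + 1)))) = framingExponent a μ := by
  rw [← Finset.sum_add_distrib, Fintype.sum_sigma, framingExponent]
  refine Finset.sum_congr rfl fun i _ => ?_
  rw [Finset.sum_range]
  refine Finset.sum_congr rfl fun t _ => ?_
  simp only [Hooks.arm, Hooks.leg]
  ring

theorem detTerm_eq {v : K} (hv : v ≠ 0) (a : Fin 3 → ℤ) {μ : Fin 3 → YoungDiagram} {N : ℕ}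
    {J : SumIndex fun i => diagLen (μ i)} (hJ : J.IsBounded N) :
    detTerm v a μ J = v ^ framingExponent a μ * minorTerm v μ (J.labels N) := by
  rw [minorTerm_labels v hJ hv, detTerm, framingExponent]
  ring

theorem support_detTerm_subset (v : K) (a : Fin 3 → ℤ) {μ : Fin 3 → YoungDiagram} {N : ℕ}
    (hN : ∀ x : Hooks μ, x.arm < N) :
    Function.support (detTerm v a μ) ⊆ {J | J.IsBounded N} := by
  intro J hJ
  by_contra h
  exact hJ (by rw [detTerm, prod_blockDet_eq_zero v hN h, mul_zero])

theorem finite_setOf_isBounded (N : ℕ) (k : Fin 3 → ℕ) : {J : SumIndex k | J.IsBounded N}.Finite :=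
  Set.Finite.of_finite_image (Set.toFinite _) (SumIndex.labels_injOn N k)

theorem exists_arm_lt (μ : Fin 3 → YoungDiagram) : ∃ N, ∀ x : Hooks μ, x.arm < N :=
  ⟨∑ x : Hooks μ, x.arm + 1, fun x => Nat.lt_succ_of_le
    (Finset.single_le_sum (f := fun x : Hooks μ => x.arm) (fun _ _ => Nat.zero_le _) (Finset.mem_univ x))⟩

variable [CompleteSpace K]

theorem det_hookMatrix {v : K} (hv : 1 < ‖v‖) (a : Fin 3 → ℤ) (μ : Fin 3 → YoungDiagram) {N : ℕ}
    (hN : ∀ x : Hooks μ, x.arm < N) :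
    (hookMatrix μ v a).det = (-1) ^ (∑ x : Hooks μ, x.leg) * (v ^ framingExponent a μ *
      (of fun x y : Hooks μ => coreEntry v N x.1 y.1 x.arm y.leg).det) := by
  have h0 := ne_zero_of_one_lt_norm hv
  have h : hookMatrix μ v a = of fun x y => v ^ (6 * (a x.1 * ((x.arm : ℤ) * (x.arm + 1)))) *
      (of fun x y : Hooks μ => ((-1) ^ y.leg * v ^ (-(6 * (a y.1 * ((y.leg : ℤ) * (y.leg + 1)))))) *
        (of fun x y : Hooks μ => coreEntry v N x.1 y.1 x.arm y.leg) x y) x y := by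
    ext x y
    exact framedCoeff_eq hv a x.1 y.1 (hN x)
  rw [h, det_mul_column, det_mul_row, Finset.prod_mul_distrib, Finset.prod_pow_eq_pow_sum,
    prod_zpow_eq_zpow_sum h0, prod_zpow_eq_zpow_sum h0, ← sum_hooks_eq_framingExponent,
    zpow_add₀ h0]
  ring

theorem fermionicVertex_eq_sum_minorTerm [CharZero K] {v : K} (hv : 1 < ‖v‖) (a : Fin 3 → ℤ)
    (μ : Fin 3 → YoungDiagram) {N : ℕ} (hN : ∀ x : Hooks μ, x.arm < N) :
    fermionicVertex v a μ =
      ∑ T : Finset (BorderLabel N), v ^ framingExponent a μ * minorTerm v μ T := by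
  rw [fermionicVertex_eq_det, det_hookMatrix hv a μ hN, ← mul_assoc, ← pow_add, ← two_mul,
    pow_mul, neg_one_sq, one_pow, one_mul, det_coreEntry, Finset.mul_sum]

/-- Both sides become sums over sets of labels below a cutoff `N` above all arms. Unbounded indices
contribute nothing, bounded ones correspond injectively to their label sets, and every set with a
nonzero minor arises in this way. -/
theorem fermionicVertex_eq_finsum_detTerm [CharZero K] {v : K} (hv : 1 < ‖v‖) (a : Fin 3 → ℤ)
    (μ : Fin 3 → YoungDiagram) : fermionicVertex v a μ = ∑ᶠ J, detTerm v a μ J := by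
  obtain ⟨N, hN⟩ := exists_arm_lt μ
  have h0 := ne_zero_of_one_lt_norm hv
  have h1 : ∑ᶠ J, detTerm v a μ J =
      ∑ᶠ J ∈ {J : SumIndex fun i => diagLen (μ i) | J.IsBounded N}, detTerm v a μ J := by
    exact finsum_eq_finsum_mem_of_support_subset (support_detTerm_subset v a hN)
  have h2 : ∑ᶠ J ∈ {J : SumIndex fun i => diagLen (μ i) | J.IsBounded N}, detTerm v a μ J =
      ∑ᶠ T ∈ SumIndex.labels N '' {J : SumIndex fun i => diagLen (μ i) | J.IsBounded N},
        v ^ framingExponent a μ * minorTerm v μ T := by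
    rw [finsum_mem_image (SumIndex.labels_injOn N _)]
    exact finsum_mem_congr rfl fun J hJ => detTerm_eq h0 a hJ
  rw [fermionicVertex_eq_sum_minorTerm hv a μ hN, h1, h2, ← finsum_eq_sum_of_fintype]
  refine finsum_eq_finsum_mem_of_support_subset fun T hT => ?_
  exact exists_sumIndex_of_minorTerm_ne_zero v (right_ne_zero_of_mul hT)

end DeterminantalFormula

end FramedVertex

/-- Determinantal form of the fermionic matrix elements in the three-legged case, for
`q = v ^ 12` with `1 < ‖v‖`, integral framings `a` and arbitrary partitions `μ 0`, `μ 1`, `μ 2`.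
The first two conjuncts say that both sides of the identity are finite sums. -/
theorem mainTheorem3 {K : Type*} [NormedField K] [CompleteSpace K] [CharZero K]
    (v : K) (hv : 1 < ‖v‖) (a : Fin 3 → ℤ) (μ : Fin 3 → YoungDiagram) :
    (Function.support (FramedVertex.wordTerm v a μ)).Finite ∧
    (Function.support (FramedVertex.detTerm v a μ)).Finite ∧
    FramedVertex.fermionicVertex v a μ =
      ∑ᶠ J : FramedVertex.SumIndex fun i => FramedVertex.diagLen (μ i),
        FramedVertex.detTerm v a μ J := by
  obtain ⟨N, hN⟩ := FramedVertex.exists_arm_lt μ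
  exact ⟨FramedVertex.finite_support_wordTerm μ v a,
    (FramedVertex.finite_setOf_isBounded N _).subset (FramedVertex.support_detTerm_subset v a hN),
    FramedVertex.fermionicVertex_eq_finsum_detTerm hv a μ⟩
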